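/- Let $f\colon\mathbb R^n\to\mathbb R$, $g\colon\mathbb R^n\to\mathbb R^\ell$, $h\colon\mathbb R^n\to\mathbb R^m$ and $G,H\colon\mathbb R^n\to\mathbb R^p$ be twice continuously differentiable, and consider the mathematical program with complementarity constraints $$\min_x f(x)\quad\text{s.t.}\quad g(x)\le 0,\; h(x)=0,\; G(x)\ge 0,\; H(x)\ge 0,\; G(x)^\top H(x)=0. \tag{MPCC}$$ Let $\mathcal L(x,\lambda,\eta,\mu,\nu)=f(x)+\lambda^\top g(x)+\eta^\top h(x)+\mu^\top G(x)+\nu^\top H(x)$. For a feasible point $\bar x$ put $I^g=\{i: g_i(\bar x)=0\}$, $I^{+0}=\{i: G_i(\bar x)>0,\,H_i(\bar x)=0\}$, $I^{0+}=\{i: G_i(\bar x)=0,\,H_i(\bar x)>0\}$, $I^{00}=\{i: G_i(\bar x)=H_i(\bar x)=0\}$. *M-stationarity.* $\Lambda^{\rm M}(\bar x)$ is the set of all $(\lambda,\eta,\mu,\nu)\in\mathbb R^\ell\times\mathbb R^m\times\mathbb R^p\times\mathbb R^p$ with $\nabla_x\mathcal L(\bar x,\lambda,\eta,\mu,\nu)=0$;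 $\lambda_i\ge 0$ for $i\in I^g$ and $\lambda_i=0$ for $i\notin I^g$; $\mu_i=0$ for $i\in I^{+0}$; $\nu_i=0$ for $i\in I^{0+}$; and $\mu_i\nu_i=0$ or ($\mu_i<0$ and $\nu_i<0$) for every $i\in I^{00}$. The feasible point $\bar x$ is M-stationary if $\Lambda^{\rm M}(\bar x)\neq\emptyset$. *MPCC-LICQ* holds at $\bar x$ if the gradients $\nabla g_i(\bar x)$ ($i\in I^g$), $\nabla h_i(\bar x)$ ($i=1,\dots,m$), $\nabla G_i(\bar x)$ ($i\in I^{0+}\cup I^{00}$), $\nabla H_i(\bar x)$ ($i\in I^{+0}\cup I^{00}$) form a linearly independent family. *MPCC-SSOC* holds at $\bar x$ with respect to $(\lambda,\eta,\mu,\nu)\in\Lambda^{\rm M}(\bar x)$ if $d^\top\nabla^2_{xx}\mathcal L(\bar x,\lambda,\eta,\mu,\nu)\,d>0$ for every $d\neq 0$ with: $\nabla g_i(\bar x)^\top d=0$ for $i\in I^g$ with $\lambda_i>0$; $h'(\bar x)d=0$; $\nabla G_i(\bar x)^\top d=0$ for $i\in I^{0+}$ and for $i\in I^{00}$ with $\mu_i\ne0$;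 $\nabla H_i(\bar x)^\top d=0$ for $i\in I^{+0}$ and for $i\in I^{00}$ with $\nu_i\neq 0$; $(\nabla G_i(\bar x)^\top d)(\nabla H_i(\bar x)^\top d)=0$ for $i\in I^{00}$ with $\mu_i=\nu_i=0$. *The function $\varphi$.* Use the following conventions for Newton derivatives: $D\min(v_1,\dots,v_k)=e_i^\top$, where $i$ is the smallest index with $v_i=\min_j v_j$; $D\max(v_1,\dots,v_k)=e_i^\top$, where $i$ is the smallest index with $v_i=\max_j v_j$; $D|\cdot|(t)=1$ if $t\ge0$ and $-1$ if $t<0$; compositions are differentiated formally by the chain rule. For $w=(a,b,\mu,\nu)\in\mathbb R^4$ let $\psi_1(w)=\max(-a,|b|,|\mu|)$, $\psi_2(w)=\max(-b,|a|,|\nu|)$, $\psi_3(w)=\max(|a|,|b|,\mu,\nu)$, $\varphi_1=\min(\psi_1,\psi_2,\psi_3)$, with $D\varphi_1$ formed by these conventions (arguments in the order written), so that $D\varphi_1(w)\in\{\pm e_1^\top,\dots,\pm e_4^\top\}$. Let $$\varphi_2(w)=\begin{cases}\min(|b|,|\nu|)&\text{if } D\varphi_1(w)=\pm e_1^\top,\\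 \min(|a|,|\mu|)&\text{if } D\varphi_1(w)=\pm e_2^\top,\\ |b|&\text{if } D\varphi_1(w)=\pm e_3^\top,\\ |a|&\text{if } D\varphi_1(w)=\pm e_4^\top,\end{cases}$$ and define $D\varphi_2$ by the same distinction of cases and the same conventions. Put $\varphi=(\varphi_1,\varphi_2)\colon\mathbb R^4\to\mathbb R^2$, and let $D\varphi(w)\in\mathbb R^{2\times4}$ have the rows $D\varphi_1(w)$, $D\varphi_2(w)$. *The Newton method.* For $z=(x,\lambda,\eta,\mu,\nu)$ let $$F(z)=\Bigl(\nabla_x\mathcal L(z),\ [\min(-g_i(x),\lambda_i)]_{i=1}^{\ell},\ h(x),\ [\varphi(G_i(x),H_i(x),\mu_i,\nu_i)]_{i=1}^{p}\Bigr)\in\mathbb R^n\times\mathbb R^\ell\times\mathbb R^m\times\mathbb R^{2p},$$ and let $DF(z)$ be the square matrix that maps $(\delta x,\delta\lambda,\delta\eta,\delta\mu,\delta\nu)$ to the vector with the blocks $\nabla^2_{xx}\mathcal L(z)\delta x+g'(x)^\top\delta\lambda+h'(x)^\top\delta\eta+G'(x)^\top\delta\mu+H'(x)^\top\delta\nu$;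 $\ D\min(-g_i(x),\lambda_i)\,(-\nabla g_i(x)^\top\delta x,\ \delta\lambda_i)^\top$, $i=1,\dots,\ell$; $\ h'(x)\delta x$; $\ D\varphi(G_i(x),H_i(x),\mu_i,\nu_i)\,(\nabla G_i(x)^\top\delta x,\ \nabla H_i(x)^\top\delta x,\ \delta\mu_i,\ \delta\nu_i)^\top$, $i=1,\dots,p$. The nonsmooth Newton method is the iteration $z_{k+1}=z_k-DF(z_k)^{-1}F(z_k)$, $k=0,1,\dots$; it is well defined for $z_0$ if all the matrices $DF(z_k)$ are invertible. **Theorem.** Let $\bar x$ be an M-stationary point of (MPCC) at which MPCC-LICQ holds, and assume that MPCC-SSOC holds at $\bar x$ with respect to the multipliers $(\bar\lambda,\bar\eta,\bar\mu,\bar\nu)\in\Lambda^{\rm M}(\bar x)$. Set $\bar z=(\bar x,\bar\lambda,\bar\eta,\bar\mu,\bar\nu)$. Then there exists $\delta>0$ such that for each $z_0$ in the closed $\delta$-ball around $\bar z$ the nonsmooth Newton method is well defined and the sequence $(z_k)$ converges superlinearly to $\bar z$, i.e. $z_k\to\bar z$ and $\|z_{k+1}-\bar z\|=o(\|z_k-\bar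 z\|)$ as $k\to\infty$. If, additionally, the second-order derivatives of $f,g,h,G,H$ are locally Lipschitz continuous, then for each such $z_0$ the convergence is quadratic, i.e. there is a constant $C$ with $\|z_{k+1}-\bar z\|\le C\|z_k-\bar z\|^2$ for all $k$. -/

import Mathlib

noncomputable section

/-! ### Priority conventions for derivatives of `min`, `max`, and `|·|` -/

/-- The smallest index at which the entry of `v` is minimal. -/
def firstArgmin {k : ℕ} (v : Fin (k + 1) → ℝ) : Fin (k + 1) :=
  (Finset.univ.filter fun j => ∀ i, v j ≤ v i).min' (by
    obtain ⟨j, hj⟩ := Finite.exists_min v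
    exact ⟨j, by simpa using hj⟩)

/-- The smallest index at which the entry of `v` is maximal. -/
def firstArgmax {k : ℕ} (v : Fin (k + 1) → ℝ) : Fin (k + 1) :=
  (Finset.univ.filter fun j => ∀ i, v i ≤ v j).min' (by
    obtain ⟨j, hj⟩ := Finite.exists_max v
    exact ⟨j, by simpa using hj⟩)

/-- Newton derivative (a row vector) of `(v₁, …, v_k) ↦ min (v₁, …, v_k)`:
the unit vector of the first entry that attains the minimum. -/
def DMin {k : ℕ} (v : Fin (k + 1) → ℝ) : Fin (k + 1) → ℝ :=
  Pi.single (firstArgmin v) 1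

/-- Newton derivative (a row vector) of `(v₁, …, v_k) ↦ max (v₁, …, v_k)`:
the unit vector of the first entry that attains the maximum. -/
def DMax {k : ℕ} (v : Fin (k + 1) → ℝ) : Fin (k + 1) → ℝ :=
  Pi.single (firstArgmax v) 1

/-- Newton derivative of the absolute value. -/
def DAbs (t : ℝ) : ℝ := if 0 ≤ t then 1 else -1

/-! ### The nonlinear M-stationarity function

A vector `w : Fin 4 → ℝ` stands for `(a, b, μ, ν)`. Derivatives of compositions are
given by the chain rule, i.e. products of a row vector and a matrix. -/

/-- `ψ₁(a, b, μ, ν) = max (-a, |b|, |μ|)`. -/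
def psi1 (w : Fin 4 → ℝ) : ℝ := max (-w 0) (max |w 1| |w 2|)

/-- `ψ₂(a, b, μ, ν) = max (-b, |a|, |ν|)`. -/
def psi2 (w : Fin 4 → ℝ) : ℝ := max (-w 1) (max |w 0| |w 3|)

/-- `ψ₃(a, b, μ, ν) = max (|a|, |b|, μ, ν)`. -/
def psi3 (w : Fin 4 → ℝ) : ℝ := max |w 0| (max |w 1| (max (w 2) (w 3)))

/-- `φ₁ = min (ψ₁, ψ₂, ψ₃)`. -/
def phi1 (w : Fin 4 → ℝ) : ℝ := min (psi1 w) (min (psi2 w) (psi3 w))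

def DPsi1 (w : Fin 4 → ℝ) : Fin 4 → ℝ :=
  Matrix.vecMul (DMax ![-w 0, |w 1|, |w 2|])
    !![-1, 0, 0, 0;
       0, DAbs (w 1), 0, 0;
       0, 0, DAbs (w 2), 0]

def DPsi2 (w : Fin 4 → ℝ) : Fin 4 → ℝ :=
  Matrix.vecMul (DMax ![-w 1, |w 0|, |w 3|])
    !![0, -1, 0, 0;
       DAbs (w 0), 0, 0, 0;
       0, 0, 0, DAbs (w 3)]

def DPsi3 (w : Fin 4 → ℝ) : Fin 4 → ℝ :=
  Matrix.vecMul (DMax ![|w 0|, |w 1|, w 2, w 3])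
    !![DAbs (w 0), 0, 0, 0;
       0, DAbs (w 1), 0, 0;
       0, 0, 1, 0;
       0, 0, 0, 1]

/-- Newton derivative of `φ₁`. Its values are signed unit vectors. -/
def DPhi1 (w : Fin 4 → ℝ) : Fin 4 → ℝ :=
  Matrix.vecMul (DMin ![psi1 w, psi2 w, psi3 w])
    (Matrix.of ![DPsi1 w, DPsi2 w, DPsi3 w])

/-- `v = ± e_i`. -/
def IsSignedUnit (i : Fin 4) (v : Fin 4 → ℝ) : Prop :=
  v = Pi.single i 1 ∨ v = -Pi.single i 1

open Classical in
/-- The discontinuous second component of the function `φ`. The last case is the one in which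
`D φ₁` equals `± e₄`. -/
def phi2 (w : Fin 4 → ℝ) : ℝ :=
  if IsSignedUnit 0 (DPhi1 w) then min |w 1| |w 3|
  else if IsSignedUnit 1 (DPhi1 w) then min |w 0| |w 2|
  else if IsSignedUnit 2 (DPhi1 w) then |w 1|
  else |w 0|

open Classical in
/-- Newton derivative of `φ₂`, by the same distinction of cases. -/
def DPhi2 (w : Fin 4 → ℝ) : Fin 4 → ℝ :=
  if IsSignedUnit 0 (DPhi1 w) then
    Matrix.vecMul (DMin ![|w 1|, |w 3|])
      !![0, DAbs (w 1), 0, 0;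
         0, 0, 0, DAbs (w 3)]
  else if IsSignedUnit 1 (DPhi1 w) then
    Matrix.vecMul (DMin ![|w 0|, |w 2|])
      !![DAbs (w 0), 0, 0, 0;
         0, 0, DAbs (w 2), 0]
  else if IsSignedUnit 2 (DPhi1 w) then ![0, DAbs (w 1), 0, 0]
  else ![DAbs (w 0), 0, 0, 0]

/-- The nonlinear M-stationarity function `φ = (φ₁, φ₂)`. -/
def phi (w : Fin 4 → ℝ) : Fin 2 → ℝ := ![phi1 w, phi2 w]

/-- Newton derivative of `φ`, with rows `D φ₁` and `D φ₂`. -/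
def DPhi (w : Fin 4 → ℝ) : Matrix (Fin 2) (Fin 4) ℝ := Matrix.of ![DPhi1 w, DPhi2 w]

/-! ### Mathematical programs with complementarity constraints -/

/-- `ℝᵏ` with its Euclidean norm. -/
abbrev Vec (k : ℕ) : Type := EuclideanSpace ℝ (Fin k)

/-- Data of the problem: minimize `f x` subject to `g x ≤ 0`, `h x = 0`, `G x ≥ 0`, `H x ≥ 0`,
`G(x)ᵀ H(x) = 0`. -/
structure MPCC (n ℓ m p : ℕ) where
  f : Vec n → ℝ
  g : Vec n → Vec ℓ
  h : Vec n → Vec m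
  G : Vec n → Vec p
  H : Vec n → Vec p

/-- Gradient of the `i`-th component of a vector-valued map. -/
def gradComp {n k : ℕ} (u : Vec n → Vec k) (i : Fin k) (x : Vec n) : Vec n :=
  gradient (fun y => u y i) x

/-- The space of `z = (x, λ, η, μ, ν)`. -/
abbrev PrimalDual (n ℓ m p : ℕ) : Type := Vec n × Vec ℓ × Vec m × Vec p × Vec p

/-- The space `ℝⁿ × ℝˡ × ℝᵐ × ℝ²ᵖ` of values of `F`; the last block is indexed by the pairs
(complementarity constraint, component of `φ`). -/
abbrev Residual (n ℓ m p : ℕ) : Type :=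
  Vec n × Vec ℓ × Vec m × EuclideanSpace ℝ (Fin p × Fin 2)

/-- A linear map between finite-dimensional normed spaces as a continuous linear map. -/
def LinearMap.toCLMOfNormed {E E' : Type*} [NormedAddCommGroup E] [NormedSpace ℝ E]
    [FiniteDimensional ℝ E] [NormedAddCommGroup E'] [NormedSpace ℝ E']
    (A : E →ₗ[ℝ] E') : E →L[ℝ] E' :=
  LinearMap.toContinuousLinearMap A

namespace MPCC

variable {n ℓ m p : ℕ} (P : MPCC n ℓ m p)

def IsFeasible (x : Vec n) : Prop :=
  (∀ i, P.g x i ≤ 0) ∧ (∀ i, P.h x i = 0) ∧ (∀ i, 0 ≤ P.G x i) ∧ (∀ i, 0 ≤ P.H x i) ∧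
    ∑ i, P.G x i * P.H x i = 0

/-- The MPCC-tailored Lagrangian. -/
def lagrangian (x : Vec n) (lam : Vec ℓ) (eta : Vec m) (mu nu : Vec p) : ℝ :=
  P.f x + ∑ i, lam i * P.g x i + ∑ i, eta i * P.h x i + ∑ i, mu i * P.G x i
    + ∑ i, nu i * P.H x i

/-- Gradient of the Lagrangian with respect to `x`. -/
def gradLagrangian (x : Vec n) (lam : Vec ℓ) (eta : Vec m) (mu nu : Vec p) : Vec n :=
  gradient (fun y => P.lagrangian y lam eta mu nu) x

/-- Hessian of the Lagrangian with respect to `x`, as a linear operator. -/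
def hessLagrangian (x : Vec n) (lam : Vec ℓ) (eta : Vec m) (mu nu : Vec p) :
    Vec n →L[ℝ] Vec n :=
  fderiv ℝ (fun y => P.gradLagrangian y lam eta mu nu) x

/-- Active inequality constraints. -/
def Ig (x : Vec n) : Set (Fin ℓ) := {i | P.g x i = 0}

def IPosZero (x : Vec n) : Set (Fin p) := {i | 0 < P.G x i ∧ P.H x i = 0}

def IZeroPos (x : Vec n) : Set (Fin p) := {i | P.G x i = 0 ∧ 0 < P.H x i}

/-- Biactive complementarity constraints. -/
def IZeroZero (x : Vec n) : Set (Fin p) := {i | P.G x i = 0 ∧ P.H x i = 0}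

/-- The set `Λᴹ(x)` of multipliers `(λ, η, μ, ν)` solving the system of M-stationarity at `x`. -/
def multipliersM (x : Vec n) : Set (Vec ℓ × Vec m × Vec p × Vec p) :=
  {q | match q with
    | (lam, eta, mu, nu) =>
      P.gradLagrangian x lam eta mu nu = 0 ∧
      (∀ i ∈ P.Ig x, 0 ≤ lam i) ∧ (∀ i ∉ P.Ig x, lam i = 0) ∧
      (∀ i ∈ P.IPosZero x, mu i = 0) ∧
      (∀ i ∈ P.IZeroPos x, nu i = 0) ∧
      (∀ i ∈ P.IZeroZero x, mu i * nu i = 0 ∨ (mu i < 0 ∧ nu i < 0))}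

def IsMStationary (x : Vec n) : Prop :=
  P.IsFeasible x ∧ (P.multipliersM x).Nonempty

/-- MPCC-LICQ: the rows of the matrix composed of `g'(x)` (active rows), `h'(x)`,
`G'(x)` (rows in `I⁰⁺ ∪ I⁰⁰`), and `H'(x)` (rows in `I⁺⁰ ∪ I⁰⁰`) are linearly independent. -/
def LICQ (x : Vec n) : Prop :=
  LinearIndependent ℝ
    (Sum.elim (fun i : P.Ig x => gradComp P.g i x)
      (Sum.elim (fun i : Fin m => gradComp P.h i x)
        (Sum.elim (fun i : ↥(P.IZeroPos x ∪ P.IZeroZero x) => gradComp P.G i x)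
          (fun i : ↥(P.IPosZero x ∪ P.IZeroZero x) => gradComp P.H i x))))

/-- The set `S(x, λ, μ, ν)` of directions in the strong second-order condition. -/
def ssocDirections (x : Vec n) (lam : Vec ℓ) (mu nu : Vec p) : Set (Vec n) :=
  {d | (∀ i ∈ P.Ig x, 0 < lam i → inner ℝ (gradComp P.g i x) d = 0) ∧
    (∀ i, inner ℝ (gradComp P.h i x) d = 0) ∧
    (∀ i ∈ P.IZeroPos x ∪ {j ∈ P.IZeroZero x | mu j ≠ 0},
      inner ℝ (gradComp P.G i x) d = 0) ∧
    (∀ i ∈ P.IPosZero x ∪ {j ∈ P.IZeroZero x | nu j ≠ 0},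
      inner ℝ (gradComp P.H i x) d = 0) ∧
    (∀ i ∈ {j ∈ P.IZeroZero x | mu j = 0 ∧ nu j = 0},
      inner ℝ (gradComp P.G i x) d * inner ℝ (gradComp P.H i x) d = 0)}

/-- MPCC-SSOC at `x` with respect to the multipliers `(λ, η, μ, ν)`. -/
def SSOC (x : Vec n) (lam : Vec ℓ) (eta : Vec m) (mu nu : Vec p) : Prop :=
  ∀ d ∈ P.ssocDirections x lam mu nu, d ≠ 0 →
    0 < inner ℝ d (P.hessLagrangian x lam eta mu nu d)

/-! ### The nonsmooth system and its Newton derivative -/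

/-- The argument `(G_i(x), H_i(x), μ_i, ν_i)` of `φ`. -/
def compArg (z : PrimalDual n ℓ m p) (i : Fin p) : Fin 4 → ℝ :=
  match z with
  | (x, _, _, mu, nu) => ![P.G x i, P.H x i, mu i, nu i]

/-- `F(x, λ, η, μ, ν) = (∇ₓL, [min (-g_i(x), λ_i)]_i, h(x), [φ(G_i(x), H_i(x), μ_i, ν_i)]_i)`. -/
def F (z : PrimalDual n ℓ m p) : Residual n ℓ m p :=
  match z with
  | (x, lam, eta, mu, nu) =>
    (P.gradLagrangian x lam eta mu nu,
      WithLp.toLp 2 fun i => min (-P.g x i) (lam i),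
      P.h x,
      WithLp.toLp 2 fun ic => phi (P.compArg (x, lam, eta, mu, nu) ic.1) ic.2)

/-- Action of the Newton matrix `DF(z)` on a vector `(δx, δλ, δη, δμ, δν)`. -/
def DFFun (z d : PrimalDual n ℓ m p) : Residual n ℓ m p :=
  match z, d with
  | (x, lam, eta, mu, nu), (dx, dlam, deta, dmu, dnu) =>
    (P.hessLagrangian x lam eta mu nu dx + ∑ i, dlam i • gradComp P.g i x
        + ∑ i, deta i • gradComp P.h i x + ∑ i, dmu i • gradComp P.G i x
        + ∑ i, dnu i • gradComp P.H i x,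
      WithLp.toLp 2 fun i =>
        DMin ![-P.g x i, lam i] 0 * (-inner ℝ (gradComp P.g i x) dx)
          + DMin ![-P.g x i, lam i] 1 * dlam i,
      WithLp.toLp 2 fun i => inner ℝ (gradComp P.h i x) dx,
      WithLp.toLp 2 fun ic =>
        Matrix.mulVec (DPhi (P.compArg (x, lam, eta, mu, nu) ic.1))
          ![inner ℝ (gradComp P.G ic.1 x) dx, inner ℝ (gradComp P.H ic.1 x) dx,
            dmu ic.1, dnu ic.1] ic.2)

theorem DFFun_add (z d e : PrimalDual n ℓ m p) :
    P.DFFun z (d + e) = P.DFFun z d + P.DFFun z e := by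
  obtain ⟨x, lam, eta, mu, nu⟩ := z
  obtain ⟨d1, d2, d3, d4, d5⟩ := d
  obtain ⟨e1, e2, e3, e4, e5⟩ := e
  simp only [DFFun, Prod.mk_add_mk, Prod.mk.injEq]
  refine ⟨?_, ?_, ?_, ?_⟩
  · simp only [map_add, PiLp.add_apply, add_smul, Finset.sum_add_distrib]
    abel
  · ext i
    simp only [inner_add_right, PiLp.add_apply]
    ring
  · ext i
    simp only [inner_add_right, PiLp.add_apply]
  · ext i
    simp only [inner_add_right, PiLp.add_apply, Matrix.mulVec, dotProduct, Fin.sum_univ_four,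
      Matrix.cons_val]
    ring

theorem DFFun_smul (z : PrimalDual n ℓ m p) (c : ℝ) (d : PrimalDual n ℓ m p) :
    P.DFFun z (c • d) = c • P.DFFun z d := by
  obtain ⟨x, lam, eta, mu, nu⟩ := z
  obtain ⟨d1, d2, d3, d4, d5⟩ := d
  simp only [DFFun, Prod.smul_mk, Prod.mk.injEq]
  refine ⟨?_, ?_, ?_, ?_⟩
  · simp only [map_smul, PiLp.smul_apply, smul_add, Finset.smul_sum, smul_smul, smul_eq_mul]
  · ext i
    simp only [inner_smul_right, PiLp.smul_apply, smul_eq_mul]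
    ring
  · ext i
    simp only [inner_smul_right, PiLp.smul_apply, smul_eq_mul]
  · ext i
    simp only [inner_smul_right, PiLp.smul_apply, smul_eq_mul, Matrix.mulVec, dotProduct,
      Fin.sum_univ_four, Matrix.cons_val]
    ring

/-- The Newton matrix `DF(z)` as a linear map. -/
def DFLin (z : PrimalDual n ℓ m p) : PrimalDual n ℓ m p →ₗ[ℝ] Residual n ℓ m p where
  toFun := P.DFFun z
  map_add' := P.DFFun_add z
  map_smul' := P.DFFun_smul z

/-- The Newton derivative `DF(z)` of `F`. -/
def DF (z : PrimalDual n ℓ m p) : PrimalDual n ℓ m p →L[ℝ] Residual n ℓ m p :=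
  LinearMap.toCLMOfNormed (P.DFLin z)

/-- The second-order derivatives of all data functions are locally Lipschitz continuous. -/
def HasLocallyLipschitzSecondDerivatives : Prop :=
  LocallyLipschitz (fderiv ℝ (fderiv ℝ P.f)) ∧ LocallyLipschitz (fderiv ℝ (fderiv ℝ P.g)) ∧
    LocallyLipschitz (fderiv ℝ (fderiv ℝ P.h)) ∧ LocallyLipschitz (fderiv ℝ (fderiv ℝ P.G)) ∧
    LocallyLipschitz (fderiv ℝ (fderiv ℝ P.H))

end MPCC

/-! ### Semismooth Newton method -/

section Newton

variable {E E' : Type*} [NormedAddCommGroup E] [NormedSpace ℝ E]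
  [NormedAddCommGroup E'] [NormedSpace ℝ E']

/-- The iteration `z_{k+1} = z_k - DΦ(z_k)⁻¹ Φ(z_k)`. It is well defined if every `DΦ(z_k)` is
invertible (`ContinuousLinearMap.inverse` is zero at non-invertible maps). -/
def newtonSeq (Φ : E → E') (DΦ : E → E →L[ℝ] E') (z₀ : E) : ℕ → E
  | 0 => z₀
  | k + 1 => newtonSeq Φ DΦ z₀ k -
      (DΦ (newtonSeq Φ DΦ z₀ k)).inverse (Φ (newtonSeq Φ DΦ z₀ k))

/-- All Newton matrices along the iteration started at `z₀` are invertible. -/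
def NewtonWellDefined (Φ : E → E') (DΦ : E → E →L[ℝ] E') (z₀ : E) : Prop :=
  ∀ k, (DΦ (newtonSeq Φ DΦ z₀ k)).IsInvertible

/-- `z_k → a` and `‖z_{k+1} - a‖ = o(‖z_k - a‖)`. -/
def ConvergesSuperlinearly (z : ℕ → E) (a : E) : Prop :=
  Filter.Tendsto z Filter.atTop (nhds a) ∧
    (fun k => z (k + 1) - a) =o[Filter.atTop] (fun k => z k - a)

/-- `z_k → a` and `‖z_{k+1} - a‖ ≤ C ‖z_k - a‖²` for all `k`, with a constant `C`. -/
def ConvergesQuadratically (z : ℕ → E) (a : E) : Prop :=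
  Filter.Tendsto z Filter.atTop (nhds a) ∧
    ∃ C : ℝ, ∀ k, ‖z (k + 1) - a‖ ≤ C * ‖z k - a‖ ^ 2

end Newton

end

/-!
The system `F z = 0` has the form `F z = A_z (S z)`, where `S` (`MPCC.smoothData`) is a `C¹` map
collecting `∇ₓL`, `g`, `h`, `G`, `H` and the multipliers, and `A_z` (`MPCC.selectionMap`) is a linear
map that only records which entries the conventions for `min`, `max` and `|·|` select at `z`; the
Newton derivative is `DF z = A_z ∘ S' z`. Only finitely many `A_z` occur near the solution `z̄`, and
each of them satisfies `A_z (S z̄) = 0`. Hence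
`F z - DF z (z - z̄) = A_z (S z - S z̄ - S' z (z - z̄))`, which is `o(‖z - z̄‖)` because `S` is `C¹`,
and `O(‖z - z̄‖²)` if `S'` is locally Lipschitz. If in addition every `A_z ∘ S' z̄` is invertible, then
`(DF z)⁻¹` is bounded near `z̄`, and the usual estimate for Newton's method gives the convergence
(`newtonSeq_converges_of_selection`). The discontinuity of `φ₂` plays no role in this argument.

Two facts about the problem remain. First, near a point `w̄` of the M-stationarity set, `Dφ w`
consists of two signed unit rows which select entries of `w = (a, b, μ, ν)` that vanish at `w̄`
(`eventually_admissibleDPhi`). For `φ₁` this follows from continuity and `φ₁ w̄ = 0`; for `φ₂` the same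
argument applies in each of the cases of its definition, using that `φ₁` selects `μ` or `ν` only where
`|b| ≤ φ₁ w` or `|a| ≤ φ₁ w`, respectively. The selected pair is always `{a, b}`,
`{a, ν}` or `{b, μ}`.

Second, for any such selection the linearized system is nonsingular
(`MPCC.eq_zero_of_linearized_system`): the form of the pairs makes every solution direction `dx`
admissible in MPCC-SSOC and kills all mixed products when the first equation is tested with `dx`,
so that `dx = 0`. The remaining multiplier components are supported on the index sets of MPCC-LICQ
and therefore vanish.
-/

open Filter Topology Asymptotics

/-! ### Newton's method for selections of smooth maps -/

section AbstractNewton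

variable {E E' W : Type*} [NormedAddCommGroup E] [NormedSpace ℝ E]
  [NormedAddCommGroup E'] [NormedSpace ℝ E'] [NormedAddCommGroup W] [NormedSpace ℝ W]

/-- One Newton step turns the remainder `y - T (z - a)` into the new error. -/
theorem norm_newton_step_sub_le {T : E →L[ℝ] E'} (hT : T.IsInvertible) {M : ℝ}
    (hM : ‖T.inverse‖ ≤ M) (z a : E) (y : E') :
    ‖z - T.inverse y - a‖ ≤ M * ‖y - T (z - a)‖ := by
  obtain ⟨e, rfl⟩ := hT
  rw [ContinuousLinearMap.inverse_equiv] at hM ⊢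
  have h : z - (e.symm : E' →L[ℝ] E) y - a
      = -((e.symm : E' →L[ℝ] E) (y - (e : E →L[ℝ] E') (z - a))) := by
    simp only [map_sub, ContinuousLinearEquiv.coe_coe, ContinuousLinearEquiv.symm_apply_apply]
    abel
  rw [h, norm_neg]
  exact (ContinuousLinearMap.le_opNorm _ _).trans (by gcongr)

theorem newtonSeq_halving {Φ : E → E'} {DΦ : E → E →L[ℝ] E'} {a z₀ : E} {δ M : ℝ}
    (hinv : ∀ z ∈ Metric.closedBall a δ, (DΦ z).IsInvertible ∧ ‖(DΦ z).inverse‖ ≤ M)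
    (hrem : ∀ z ∈ Metric.closedBall a δ, M * ‖Φ z - DΦ z (z - a)‖ ≤ 1 / 2 * ‖z - a‖)
    (hz₀ : z₀ ∈ Metric.closedBall a δ) (k : ℕ) :
    newtonSeq Φ DΦ z₀ k ∈ Metric.closedBall a δ ∧
      ‖newtonSeq Φ DΦ z₀ k - a‖ ≤ (1 / 2) ^ k * ‖z₀ - a‖ := by
  induction k with
  | zero => simpa [newtonSeq] using hz₀
  | succ k ih =>
    obtain ⟨hmem, hle⟩ := ih
    have hstep : ‖newtonSeq Φ DΦ z₀ (k + 1) - a‖ ≤ 1 / 2 * ‖newtonSeq Φ DΦ z₀ k - a‖ :=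
      (norm_newton_step_sub_le (hinv _ hmem).1 (hinv _ hmem).2 _ _ _).trans (hrem _ hmem)
    refine ⟨?_, ?_⟩
    · rw [mem_closedBall_iff_norm] at hmem ⊢
      linarith [norm_nonneg (newtonSeq Φ DΦ z₀ k - a)]
    · rw [pow_succ]
      nlinarith

/-- Local convergence of the Newton method. The remainder bound at `a` is what Newton
differentiability means there once `Φ a = 0`; neither continuity of `Φ` nor continuity of `DΦ`
is needed. -/
theorem newtonSeq_converges {Φ : E → E'} {DΦ : E → E →L[ℝ] E'} {a : E} {M : ℝ}
    (hinv : ∀ᶠ z in 𝓝 a, (DΦ z).IsInvertible ∧ ‖(DΦ z).inverse‖ ≤ M)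
    (hrem : (fun z => Φ z - DΦ z (z - a)) =o[𝓝 a] fun z => z - a) :
    ∃ δ : ℝ, 0 < δ ∧
      (∀ z₀ ∈ Metric.closedBall a δ,
        NewtonWellDefined Φ DΦ z₀ ∧ ConvergesSuperlinearly (newtonSeq Φ DΦ z₀) a) ∧
      ((fun z => Φ z - DΦ z (z - a)) =O[𝓝 a] (fun z => ‖z - a‖ ^ 2) →
        ∀ z₀ ∈ Metric.closedBall a δ, ConvergesQuadratically (newtonSeq Φ DΦ z₀) a) := by
  -- The quadratic estimate has to hold on the whole ball, so its radius is made to depend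
  -- on whether the quadratic remainder bound is available.
  obtain ⟨C, hC⟩ : ∃ C : ℝ, ∀ᶠ z in 𝓝 a,
      (fun z => Φ z - DΦ z (z - a)) =O[𝓝 a] (fun z => ‖z - a‖ ^ 2) →
        ‖Φ z - DΦ z (z - a)‖ ≤ C * ‖z - a‖ ^ 2 := by
    by_cases hO : (fun z => Φ z - DΦ z (z - a)) =O[𝓝 a] (fun z => ‖z - a‖ ^ 2)
    · obtain ⟨C, hC⟩ := hO.bound
      exact ⟨C, hC.mono fun z hz _ => by simpa using hz⟩
    · exact ⟨0, Eventually.of_forall fun z h => absurd h hO⟩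
  have hM : 0 ≤ M := (norm_nonneg _).trans hinv.self_of_nhds.2
  have hhalf : ∀ᶠ z in 𝓝 a, M * ‖Φ z - DΦ z (z - a)‖ ≤ 1 / 2 * ‖z - a‖ := by
    filter_upwards [hrem.def (c := 1 / (2 * (M + 1))) (by positivity)] with z hz
    calc M * ‖Φ z - DΦ z (z - a)‖ ≤ (M + 1) * (1 / (2 * (M + 1)) * ‖z - a‖) := by
          gcongr
          linarith
      _ = 1 / 2 * ‖z - a‖ := by field_simp
  obtain ⟨δ, hδ, hball⟩ :=
    Metric.nhds_basis_closedBall.eventually_iff.1 (hinv.and (hhalf.and hC))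
  have hseq := fun z₀ (hz₀ : z₀ ∈ Metric.closedBall a δ) =>
    newtonSeq_halving (fun z hz => (hball hz).1) (fun z hz => (hball hz).2.1) hz₀
  have hstep : ∀ z₀ ∈ Metric.closedBall a δ, ∀ k,
      ‖newtonSeq Φ DΦ z₀ (k + 1) - a‖
        ≤ M * ‖Φ (newtonSeq Φ DΦ z₀ k)
            - DΦ (newtonSeq Φ DΦ z₀ k) (newtonSeq Φ DΦ z₀ k - a)‖ := fun z₀ hz₀ k =>
    norm_newton_step_sub_le (hball (hseq z₀ hz₀ k).1).1.1 (hball (hseq z₀ hz₀ k).1).1.2 _ _ _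
  have htend : ∀ z₀ ∈ Metric.closedBall a δ, Tendsto (newtonSeq Φ DΦ z₀) atTop (𝓝 a) := by
    intro z₀ hz₀
    rw [tendsto_iff_norm_sub_tendsto_zero]
    refine squeeze_zero (fun k => norm_nonneg _) (fun k => (hseq z₀ hz₀ k).2) ?_
    simpa using (tendsto_pow_atTop_nhds_zero_of_lt_one (r := (1 / 2 : ℝ)) (by norm_num)
      (by norm_num)).mul_const ‖z₀ - a‖
  refine ⟨δ, hδ, fun z₀ hz₀ => ⟨fun k => (hball (hseq z₀ hz₀ k).1).1.1, htend z₀ hz₀, ?_⟩,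
    fun hO z₀ hz₀ => ⟨htend z₀ hz₀, M * C, fun k => ?_⟩⟩
  · exact (IsBigO.of_bound M (Eventually.of_forall (hstep z₀ hz₀))).trans_isLittleO
      (hrem.comp_tendsto (htend z₀ hz₀))
  · refine (hstep z₀ hz₀ k).trans ?_
    rw [mul_assoc]
    exact mul_le_mul_of_nonneg_left ((hball (hseq z₀ hz₀ k).1).2.2 hO) hM

/-- In contrast to the definition of differentiability, the derivative is taken at the moving
point `z`, as in Newton's method. -/
theorem isLittleO_sub_fderiv_sub {S : E → W} (hS : ContDiff ℝ 1 S) (a : E) :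
    (fun z => S z - S a - fderiv ℝ S z (z - a)) =o[𝓝 a] fun z => z - a := by
  have h₁ : (fun z => S z - S a - fderiv ℝ S a (z - a)) =o[𝓝 a] fun z => z - a :=
    ((hS.differentiable (by norm_num)) a).hasFDerivAt.isLittleO
  have h₂ : (fun z => (fderiv ℝ S z - fderiv ℝ S a) (z - a)) =o[𝓝 a] fun z => z - a := by
    have hc : Tendsto (fun z => ‖fderiv ℝ S z - fderiv ℝ S a‖) (𝓝 a) (𝓝 0) := by
      have := ((hS.continuous_fderiv (by norm_num)).tendsto a).sub_const (fderiv ℝ S a)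
      simpa using this.norm
    refine isLittleO_iff.2 fun c hc' => ?_
    filter_upwards [hc.eventually_lt_const hc'] with z hz
    exact (ContinuousLinearMap.le_opNorm _ _).trans (by gcongr)
  refine (h₁.sub h₂).congr_left fun z => ?_
  simp only [sub_apply]
  abel

theorem isBigO_sub_fderiv_sub {S : E → W} (hS : ContDiff ℝ 1 S)
    (hL : LocallyLipschitz (fderiv ℝ S)) (a : E) :
    (fun z => S z - S a - fderiv ℝ S z (z - a)) =O[𝓝 a] fun z => ‖z - a‖ ^ 2 := by
  obtain ⟨K, t, ht, hK⟩ := hL a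
  obtain ⟨ε, hε, hball⟩ := Metric.mem_nhds_iff.1 ht
  refine IsBigO.of_bound (2 * K) ?_
  filter_upwards [Metric.ball_mem_nhds a hε] with z hz
  have hsub : Metric.closedBall a ‖z - a‖ ⊆ t := fun y hy => hball <| by
    rw [mem_closedBall_iff_norm] at hy
    rw [mem_ball_iff_norm] at hz ⊢
    exact hy.trans_lt hz
  have hza : z ∈ Metric.closedBall a ‖z - a‖ := by rw [mem_closedBall_iff_norm]
  have haa : a ∈ Metric.closedBall a ‖z - a‖ := Metric.mem_closedBall_self (norm_nonneg _)
  have key := (convex_closedBall a ‖z - a‖).norm_image_sub_le_of_norm_hasFDerivWithin_le'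
    (f := S) (f' := fderiv ℝ S) (φ := fderiv ℝ S z) (C := 2 * K * ‖z - a‖)
    (fun y _ => ((hS.differentiable (by norm_num)) y).hasFDerivAt.hasFDerivWithinAt)
    (fun y hy => ?_) haa hza
  · rw [Real.norm_of_nonneg (by positivity)]
    calc _ ≤ _ := key
      _ = _ := by ring
  · have h := hK.norm_sub_le (hsub hy) (hsub hza)
    rw [mem_closedBall_iff_norm] at hy
    calc _ ≤ _ := h
      _ ≤ K * (‖y - a‖ + ‖z - a‖) := by
          gcongr
          simpa using norm_sub_le (y - a) (z - a)
      _ ≤ 2 * K * ‖z - a‖ := by nlinarith [K.coe_nonneg]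

theorem isInvertible_eventually_of_continuousAt [CompleteSpace E] {X : Type*} [TopologicalSpace X]
    {T : X → E →L[ℝ] E'} {a : X} (hT : ContinuousAt T a) (ha : (T a).IsInvertible) :
    ∀ᶠ z in 𝓝 a, (T z).IsInvertible ∧ ‖(T z).inverse‖ ≤ ‖(T a).inverse‖ + 1 := by
  obtain ⟨e, he⟩ := ha
  have h₁ : ∀ᶠ z in 𝓝 a, (T z).IsInvertible := by
    have := ContinuousLinearEquiv.nhds e
    rw [he] at this
    exact hT.eventually (Filter.mem_of_superset this fun T' ⟨e', he'⟩ => ⟨e', he'⟩)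
  have h₂ : ContinuousAt (fun z => ‖(T z).inverse‖) a := by
    have h₃ : ContinuousAt (ContinuousLinearMap.inverse : (E →L[ℝ] E') → _) (T a) :=
      (ContinuousLinearMap.IsInvertible.contDiffAt_map_inverse (n := 0) ⟨e, he⟩).continuousAt
    exact (ContinuousAt.comp (f := T) h₃ hT).norm
  filter_upwards [h₁, h₂.eventually_lt_const (lt_add_one _)] with z hz hz' using ⟨hz, hz'.le⟩

/-- Newton's method for a function that near `a` is a selection among finitely many linear images
`A ∘ S` of one smooth map `S`, with the matching selection `A ∘ S'` as its Newton derivative. The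
selection may jump from point to point, as long as every selected `A` satisfies `A (S a) = 0` and
has `A ∘ S' a` invertible. -/
theorem newtonSeq_converges_of_selection [CompleteSpace E]
    {Φ : E → E'} {DΦ : E → E →L[ℝ] E'} {S : E → W} (hS : ContDiff ℝ 1 S) {a : E}
    {s : Set (W →L[ℝ] E')} (hs : s.Finite)
    (hzero : ∀ A ∈ s, A (S a) = 0) (hinv : ∀ A ∈ s, (A ∘L fderiv ℝ S a).IsInvertible)
    (hsel : ∀ᶠ z in 𝓝 a, ∃ A ∈ s, Φ z = A (S z) ∧ DΦ z = A ∘L fderiv ℝ S z) :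
    ∃ δ : ℝ, 0 < δ ∧
      (∀ z₀ ∈ Metric.closedBall a δ,
        NewtonWellDefined Φ DΦ z₀ ∧ ConvergesSuperlinearly (newtonSeq Φ DΦ z₀) a) ∧
      (LocallyLipschitz (fderiv ℝ S) →
        ∀ z₀ ∈ Metric.closedBall a δ, ConvergesQuadratically (newtonSeq Φ DΦ z₀) a) := by
  obtain ⟨M, hM⟩ : ∃ M : ℝ, ∀ᶠ z in 𝓝 a, ∀ A ∈ s,
      (A ∘L fderiv ℝ S z).IsInvertible ∧ ‖(A ∘L fderiv ℝ S z).inverse‖ ≤ M := by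
    obtain ⟨M, hM⟩ := (hs.image fun A => ‖(A ∘L fderiv ℝ S a).inverse‖ + 1).bddAbove
    refine ⟨M, (eventually_all_finite hs).2 fun A hA => ?_⟩
    have hc : Continuous fun z => A ∘L fderiv ℝ S z :=
      continuous_const.clm_comp (hS.continuous_fderiv (by norm_num))
    filter_upwards [isInvertible_eventually_of_continuousAt hc.continuousAt (hinv A hA)] with z hz
    exact ⟨hz.1, hz.2.trans (hM ⟨A, hA, rfl⟩)⟩
  obtain ⟨N, hN⟩ := (hs.image fun A => ‖A‖).bddAbove
  have hO : (fun z => Φ z - DΦ z (z - a)) =O[𝓝 a]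
      fun z => S z - S a - fderiv ℝ S z (z - a) := by
    refine IsBigO.of_bound N ?_
    filter_upwards [hsel] with z ⟨A, hA, h₁, h₂⟩
    have : Φ z - DΦ z (z - a) = A (S z - S a - fderiv ℝ S z (z - a)) := by
      rw [h₁, h₂, map_sub A, map_sub A, hzero A hA, sub_zero, ContinuousLinearMap.comp_apply]
    rw [this]
    exact A.le_of_opNorm_le (hN ⟨A, hA, rfl⟩) _
  obtain ⟨δ, hδ, h₁, h₂⟩ := newtonSeq_converges (Φ := Φ) (DΦ := DΦ) (a := a) (M := M)
    (by
      filter_upwards [hM, hsel] with z hz ⟨A, hA, _, h⟩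
      rw [h]
      exact hz A hA)
    (hO.trans_isLittleO (isLittleO_sub_fderiv_sub hS a))
  exact ⟨δ, hδ, h₁, fun hL => h₂ (hO.trans (isBigO_sub_fderiv_sub hS hL a))⟩

theorem ContinuousLinearMap.isInvertible_of_ker_eq_zero {E E' : Type*} [NormedAddCommGroup E]
    [NormedSpace ℝ E] [FiniteDimensional ℝ E] [NormedAddCommGroup E'] [NormedSpace ℝ E']
    [FiniteDimensional ℝ E'] (hdim : Module.finrank ℝ E = Module.finrank ℝ E') {T : E →L[ℝ] E'}
    (hT : ∀ d, T d = 0 → d = 0) : T.IsInvertible := by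
  have hinj : Function.Injective (T : E →ₗ[ℝ] E') := (injective_iff_map_eq_zero _).2 hT
  exact ⟨(LinearMap.linearEquivOfInjective _ hinj hdim).toContinuousLinearEquiv,
    ContinuousLinearMap.ext fun d => rfl⟩

end AbstractNewton

/-! ### First minimizing and maximizing indices -/

theorem apply_firstArgmin_le {k : ℕ} (v : Fin (k + 1) → ℝ) (i : Fin (k + 1)) :
    v (firstArgmin v) ≤ v i := by
  have h := Finset.min'_mem (Finset.univ.filter fun j => ∀ i, v j ≤ v i) (by
    obtain ⟨j, hj⟩ := Finite.exists_min v
    exact ⟨j, by simpa using hj⟩)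
  exact (Finset.mem_filter.1 h).2 i

theorem le_apply_firstArgmax {k : ℕ} (v : Fin (k + 1) → ℝ) (i : Fin (k + 1)) :
    v i ≤ v (firstArgmax v) := by
  have h := Finset.min'_mem (Finset.univ.filter fun j => ∀ i, v i ≤ v j) (by
    obtain ⟨j, hj⟩ := Finite.exists_max v
    exact ⟨j, by simpa using hj⟩)
  exact (Finset.mem_filter.1 h).2 i

theorem DMin_pair (x y : ℝ) :
    (DMin ![x, y] = Pi.single 0 1 ∧ min x y = x) ∨
      (DMin ![x, y] = Pi.single 1 1 ∧ min x y = y) := by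
  have h := apply_firstArgmin_le ![x, y]
  unfold DMin
  generalize firstArgmin ![x, y] = j at h ⊢
  fin_cases j
  · exact Or.inl ⟨rfl, min_eq_left (by simpa using h 1)⟩
  · exact Or.inr ⟨rfl, min_eq_right (by simpa using h 0)⟩

theorem DMin_pair_dot (x y : ℝ) : DMin ![x, y] 0 * x + DMin ![x, y] 1 * y = min x y := by
  rcases DMin_pair x y with ⟨h, h'⟩ | ⟨h, h'⟩ <;> simp [h, h']

/-! ### The selections made by the M-stationarity function -/

/-- The row vector `r` is a signed unit vector `± e_i`, and `y` is the value `r · w`. -/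
def Selects (w : Fin 4 → ℝ) (y : ℝ) (r : Fin 4 → ℝ) (i : Fin 4) : Prop :=
  IsSignedUnit i r ∧ y = r ⬝ᵥ w

theorem selects_neg (w : Fin 4 → ℝ) (i : Fin 4) : Selects w (-w i) (-Pi.single i 1) i :=
  ⟨Or.inr rfl, by simp⟩

theorem selects_pos (w : Fin 4 → ℝ) (i : Fin 4) : Selects w (w i) (Pi.single i 1) i :=
  ⟨Or.inl rfl, by simp⟩

theorem selects_abs (w : Fin 4 → ℝ) (i : Fin 4) :
    Selects w |w i| (Pi.single i (DAbs (w i))) i := by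
  unfold DAbs
  split_ifs with h
  · rw [abs_of_nonneg h]
    exact selects_pos w i
  · rw [abs_of_neg (not_le.1 h), Pi.single_neg]
    exact selects_neg w i

theorem Selects.abs_eq {w : Fin 4 → ℝ} {y : ℝ} {r : Fin 4 → ℝ} {i : Fin 4}
    (h : Selects w y r i) : |y| = |w i| := by
  obtain ⟨rfl | rfl, rfl⟩ := h <;> simp

theorem IsSignedUnit.eq {i j : Fin 4} {v : Fin 4 → ℝ} (hi : IsSignedUnit i v)
    (hj : IsSignedUnit j v) : i = j := by
  by_contra hne
  have : v i = 0 := by rcases hj with rfl | rfl <;> simp [hne]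
  rcases hi with rfl | rfl <;> simp at this

/-- What the conventions guarantee for the value `y` and the derivative `r` of each of `ψ₁`, `ψ₂`,
`ψ₃`, `φ₁` at `w = (a, b, μ, ν)`: `y = ± w i` is nonnegative and has the matching derivative, with
`i = 2` (selection of `μ`) only if `|b| ≤ y`, and `i = 3` (selection of `ν`) only if `|a| ≤ y`. -/
def SelectsDominant (w : Fin 4 → ℝ) (y : ℝ) (r : Fin 4 → ℝ) : Prop :=
  0 ≤ y ∧ ∃ i, Selects w y r i ∧ (i = 2 → |w 1| ≤ y) ∧ (i = 3 → |w 0| ≤ y)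

theorem selectsDominant_psi1 (w : Fin 4 → ℝ) : SelectsDominant w (psi1 w) (DPsi1 w) := by
  have h1 : |w 1| ≤ psi1 w := by simp [psi1]
  refine ⟨(abs_nonneg _).trans h1, ?_⟩
  have h := le_apply_firstArgmax ![-w 0, |w 1|, |w 2|]
  unfold DPsi1 DMax
  rw [Matrix.single_one_vecMul]
  generalize firstArgmax ![-w 0, |w 1|, |w 2|] = j at h ⊢
  have h0 := h 0
  have h1' := h 1
  have h2 := h 2
  fin_cases j
  · refine ⟨0, ?_, by simp, by simp⟩
    convert selects_neg w 0 using 1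
    · simp_all [psi1]
    · ext i; fin_cases i <;> simp
  · refine ⟨1, ?_, by simp, by simp⟩
    convert selects_abs w 1 using 1
    · simp_all [psi1]
    · ext i; fin_cases i <;> simp
  · refine ⟨2, ?_, fun _ => h1, by simp⟩
    convert selects_abs w 2 using 1
    · simp_all [psi1]
    · ext i; fin_cases i <;> simp

theorem selectsDominant_psi2 (w : Fin 4 → ℝ) : SelectsDominant w (psi2 w) (DPsi2 w) := by
  have h1 : |w 0| ≤ psi2 w := by simp [psi2]
  refine ⟨(abs_nonneg _).trans h1, ?_⟩
  have h := le_apply_firstArgmax ![-w 1, |w 0|, |w 3|]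
  unfold DPsi2 DMax
  rw [Matrix.single_one_vecMul]
  generalize firstArgmax ![-w 1, |w 0|, |w 3|] = j at h ⊢
  have h0 := h 0
  have h1' := h 1
  have h2 := h 2
  fin_cases j
  · refine ⟨1, ?_, by simp, by simp⟩
    convert selects_neg w 1 using 1
    · simp_all [psi2]
    · ext i; fin_cases i <;> simp
  · refine ⟨0, ?_, by simp, by simp⟩
    convert selects_abs w 0 using 1
    · simp_all [psi2]
    · ext i; fin_cases i <;> simp
  · refine ⟨3, ?_, by simp, fun _ => h1⟩
    convert selects_abs w 3 using 1
    · simp_all [psi2]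
    · ext i; fin_cases i <;> simp

theorem selectsDominant_psi3 (w : Fin 4 → ℝ) : SelectsDominant w (psi3 w) (DPsi3 w) := by
  have hw0 : |w 0| ≤ psi3 w := by simp [psi3]
  have hw1 : |w 1| ≤ psi3 w := by simp [psi3]
  refine ⟨(abs_nonneg _).trans hw0, ?_⟩
  have h := le_apply_firstArgmax ![|w 0|, |w 1|, w 2, w 3]
  unfold DPsi3 DMax
  rw [Matrix.single_one_vecMul]
  generalize firstArgmax ![|w 0|, |w 1|, w 2, w 3] = j at h ⊢
  have h0 := h 0
  have h1 := h 1
  have h2 := h 2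
  have h3 := h 3
  fin_cases j
  · refine ⟨0, ?_, by simp, by simp⟩
    convert selects_abs w 0 using 1
    · simp_all [psi3]
    · ext i; fin_cases i <;> simp
  · refine ⟨1, ?_, by simp, by simp⟩
    convert selects_abs w 1 using 1
    · simp_all [psi3]
    · ext i; fin_cases i <;> simp
  · refine ⟨2, ?_, fun _ => hw1, by simp⟩
    convert selects_pos w 2 using 1
    · simp_all [psi3]
    · ext i; fin_cases i <;> simp
  · refine ⟨3, ?_, by simp, fun _ => hw0⟩
    convert selects_pos w 3 using 1
    · simp_all [psi3]
    · ext i; fin_cases i <;> simp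

theorem selectsDominant_phi1 (w : Fin 4 → ℝ) : SelectsDominant w (phi1 w) (DPhi1 w) := by
  have h := apply_firstArgmin_le ![psi1 w, psi2 w, psi3 w]
  unfold DPhi1 DMin
  rw [Matrix.single_one_vecMul]
  generalize firstArgmin ![psi1 w, psi2 w, psi3 w] = j at h ⊢
  have h0 := h 0
  have h1 := h 1
  have h2 := h 2
  fin_cases j
  · convert selectsDominant_psi1 w using 1
    · simp_all [phi1]
    · rfl
  · convert selectsDominant_psi2 w using 1
    · simp_all [phi1]
    · rfl
  · convert selectsDominant_psi3 w using 1
    · simp_all [phi1]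
    · rfl

/-- The entries of `w = (a, b, μ, ν)` that may be selected together by `Dφ`. In particular neither
`{a, μ}`, nor `{b, ν}`, nor `{μ, ν}` occurs. -/
def CompatiblePair (i j : Fin 4) : Prop :=
  (i = 0 ∧ j = 1) ∨ (i = 1 ∧ j = 0) ∨ (i = 0 ∧ j = 3) ∨ (i = 3 ∧ j = 0) ∨
    (i = 1 ∧ j = 2) ∨ (i = 2 ∧ j = 1)

theorem phi2_of_zero {w : Fin 4 → ℝ} (h : IsSignedUnit 0 (DPhi1 w)) :
    ∃ j, (j = 1 ∨ j = 3) ∧ Selects w (phi2 w) (DPhi2 w) j ∧ phi2 w = min |w 1| |w 3| := by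
  unfold phi2 DPhi2
  simp only [if_pos h]
  rcases DMin_pair |w 1| |w 3| with ⟨hD, hm⟩ | ⟨hD, hm⟩
  · refine ⟨1, Or.inl rfl, ?_, trivial⟩
    rw [hD, hm, Matrix.single_one_vecMul]
    convert selects_abs w 1 using 1
    ext i; fin_cases i <;> simp
  · refine ⟨3, Or.inr rfl, ?_, trivial⟩
    rw [hD, hm, Matrix.single_one_vecMul]
    convert selects_abs w 3 using 1
    ext i; fin_cases i <;> simp

theorem phi2_of_one {w : Fin 4 → ℝ} (h : IsSignedUnit 1 (DPhi1 w)) :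
    ∃ j, (j = 0 ∨ j = 2) ∧ Selects w (phi2 w) (DPhi2 w) j ∧ phi2 w = min |w 0| |w 2| := by
  have h0 : ¬ IsSignedUnit 0 (DPhi1 w) := fun h' => by simpa using h.eq h'
  unfold phi2 DPhi2
  simp only [if_neg h0, if_pos h]
  rcases DMin_pair |w 0| |w 2| with ⟨hD, hm⟩ | ⟨hD, hm⟩
  · refine ⟨0, Or.inl rfl, ?_, trivial⟩
    rw [hD, hm, Matrix.single_one_vecMul]
    convert selects_abs w 0 using 1
    ext i; fin_cases i <;> simp
  · refine ⟨2, Or.inr rfl, ?_, trivial⟩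
    rw [hD, hm, Matrix.single_one_vecMul]
    convert selects_abs w 2 using 1
    ext i; fin_cases i <;> simp

theorem phi2_of_two {w : Fin 4 → ℝ} (h : IsSignedUnit 2 (DPhi1 w)) :
    Selects w (phi2 w) (DPhi2 w) 1 := by
  have h0 : ¬ IsSignedUnit 0 (DPhi1 w) := fun h' => by simpa using h.eq h'
  have h1 : ¬ IsSignedUnit 1 (DPhi1 w) := fun h' => by simpa using h.eq h'
  unfold phi2 DPhi2
  simp only [if_neg h0, if_neg h1, if_pos h]
  convert selects_abs w 1 using 1
  ext i; fin_cases i <;> simp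

theorem phi2_of_three {w : Fin 4 → ℝ} (h : IsSignedUnit 3 (DPhi1 w)) :
    Selects w (phi2 w) (DPhi2 w) 0 := by
  have h0 : ¬ IsSignedUnit 0 (DPhi1 w) := fun h' => by simpa using h.eq h'
  have h1 : ¬ IsSignedUnit 1 (DPhi1 w) := fun h' => by simpa using h.eq h'
  have h2 : ¬ IsSignedUnit 2 (DPhi1 w) := fun h' => by simpa using h.eq h'
  unfold phi2 DPhi2
  simp only [if_neg h0, if_neg h1, if_neg h2]
  convert selects_abs w 0 using 1
  ext i; fin_cases i <;> simp

/-- The set of all `(a, b, μ, ν)` allowed by the system of M-stationarity. -/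
def mSet : Set (Fin 4 → ℝ) :=
  {w | (0 < w 0 ∧ w 1 = 0 ∧ w 2 = 0) ∨ (w 0 = 0 ∧ 0 < w 1 ∧ w 3 = 0) ∨
    (w 0 = 0 ∧ w 1 = 0 ∧ (w 2 * w 3 = 0 ∨ (w 2 < 0 ∧ w 3 < 0)))}

theorem phi1_eq_zero_of_mem_mSet {w : Fin 4 → ℝ} (hw : w ∈ mSet) : phi1 w = 0 := by
  have h1 := (selectsDominant_psi1 w).1
  have h2 := (selectsDominant_psi2 w).1
  have h3 := (selectsDominant_psi3 w).1
  refine le_antisymm ?_ (le_min h1 (le_min h2 h3))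
  have psi1_le (ha : 0 ≤ w 0) (hb : w 1 = 0) (hmu : w 2 = 0) : phi1 w ≤ 0 :=
    (min_le_left _ _).trans (by simp [psi1, ha, hb, hmu])
  have psi2_le (ha : w 0 = 0) (hb : 0 ≤ w 1) (hnu : w 3 = 0) : phi1 w ≤ 0 :=
    (min_le_right _ _).trans ((min_le_left _ _).trans (by simp [psi2, ha, hb, hnu]))
  rcases hw with ⟨ha, hb, hm⟩ | ⟨ha, hb, hn⟩ | ⟨ha, hb, h | ⟨hm, hn⟩⟩
  · exact psi1_le ha.le hb hm
  · exact psi2_le ha hb.le hn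
  · rcases mul_eq_zero.1 h with h | h
    · exact psi1_le ha.ge hb h
    · exact psi2_le ha hb.ge h
  · exact (min_le_right _ _).trans
      ((min_le_right _ _).trans (by simp [psi3, ha, hb, hm.le, hn.le]))

/-- A Newton matrix of `φ` consisting of two signed unit rows that form a compatible pair and
select entries of `w₀` that vanish. -/
def AdmissibleDPhi (w₀ : Fin 4 → ℝ) (A : Matrix (Fin 2) (Fin 4) ℝ) : Prop :=
  ∃ i j, CompatiblePair i j ∧ IsSignedUnit i (A 0) ∧ IsSignedUnit j (A 1) ∧ w₀ i = 0 ∧ w₀ j = 0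

/-- Positive homogeneity of the selected linear pieces: `φ w = Dφ(w) w`. -/
theorem phi_eq_mulVec (w : Fin 4 → ℝ) : phi w = (DPhi w).mulVec w := by
  have h2 : phi2 w = DPhi2 w ⬝ᵥ w := by
    obtain ⟨-, i, hi, -⟩ := selectsDominant_phi1 w
    fin_cases i
    · exact (phi2_of_zero hi.1).choose_spec.2.1.2
    · exact (phi2_of_one hi.1).choose_spec.2.1.2
    · exact (phi2_of_two hi.1).2
    · exact (phi2_of_three hi.1).2
  obtain ⟨-, i, hi, -⟩ := selectsDominant_phi1 w
  ext k
  fin_cases k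
  · exact hi.2
  · exact h2

/-- Near a point of the M-stationarity set, `φ` only selects entries that vanish at that point:
`φ₁` is continuous with value `0` there, and so is the part of `φ₂` that is in effect. -/
theorem eventually_admissibleDPhi {w₀ : Fin 4 → ℝ} (hw₀ : w₀ ∈ mSet) :
    ∀ᶠ w in 𝓝 w₀, AdmissibleDPhi w₀ (DPhi w) := by
  -- An entry bounded by a continuous function that vanishes at `w₀` must vanish at `w₀` itself.
  have key (q : (Fin 4 → ℝ) → ℝ) (hq : Continuous q) (h0 : q w₀ = 0) :
      ∀ᶠ w in 𝓝 w₀, ∀ i, |w i| ≤ q w → w₀ i = 0 := by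
    refine eventually_all.2 fun i => ?_
    by_cases hi : w₀ i = 0
    · exact Eventually.of_forall fun w _ => hi
    · have : ∀ᶠ w in 𝓝 w₀, q w < |w i| :=
        hq.continuousAt.eventually_lt (continuous_apply i).abs.continuousAt (by simpa [h0] using hi)
      exact this.mono fun w hw hle => absurd hw (not_lt.2 hle)
  have h1 := key phi1 (by unfold phi1 psi1 psi2 psi3; fun_prop) (phi1_eq_zero_of_mem_mSet hw₀)
  have h13 : ∀ᶠ w in 𝓝 w₀, w₀ 0 = 0 → ∀ i, |w i| ≤ min |w 1| |w 3| → w₀ i = 0 := by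
    by_cases h : w₀ 0 = 0
    · refine (key (fun w => min |w 1| |w 3|) (by fun_prop) ?_).mono fun w hw _ => hw
      rcases hw₀ with h' | h' | h'
      · exact absurd h h'.1.ne'
      · simp [h'.2.2]
      · simp [h'.2.1]
    · exact Eventually.of_forall fun w h' => absurd h' h
  have h02 : ∀ᶠ w in 𝓝 w₀, w₀ 1 = 0 → ∀ i, |w i| ≤ min |w 0| |w 2| → w₀ i = 0 := by
    by_cases h : w₀ 1 = 0
    · refine (key (fun w => min |w 0| |w 2|) (by fun_prop) ?_).mono fun w hw _ => hw
      rcases hw₀ with h' | h' | h'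
      · simp [h'.2.2]
      · exact absurd h h'.2.1.ne'
      · simp [h'.1]
    · exact Eventually.of_forall fun w h' => absurd h' h
  filter_upwards [h1, h13, h02] with w h1 h13 h02
  obtain ⟨hnn, i, hi, hi2, hi3⟩ := selectsDominant_phi1 w
  have hwi : w₀ i = 0 := h1 i (by rw [← hi.abs_eq, abs_of_nonneg hnn])
  fin_cases i
  · obtain ⟨j, hj, hsel, hval⟩ := phi2_of_zero hi.1
    have hle : |w j| ≤ min |w 1| |w 3| := by
      rw [← hsel.abs_eq, hval, abs_of_nonneg (by positivity)]
    refine ⟨0, j, ?_, hi.1, hsel.1, hwi, h13 hwi j hle⟩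
    rcases hj with rfl | rfl <;> simp [CompatiblePair]
  · obtain ⟨j, hj, hsel, hval⟩ := phi2_of_one hi.1
    have hle : |w j| ≤ min |w 0| |w 2| := by
      rw [← hsel.abs_eq, hval, abs_of_nonneg (by positivity)]
    refine ⟨1, j, ?_, hi.1, hsel.1, hwi, h02 hwi j hle⟩
    rcases hj with rfl | rfl <;> simp [CompatiblePair]
  · exact ⟨2, 1, by simp [CompatiblePair], hi.1, (phi2_of_two hi.1).1, hwi, h1 1 (hi2 rfl)⟩
  · exact ⟨3, 0, by simp [CompatiblePair], hi.1, (phi2_of_three hi.1).1, hwi, h1 0 (hi3 rfl)⟩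

theorem finite_admissibleDPhi (w₀ : Fin 4 → ℝ) : {A | AdmissibleDPhi w₀ A}.Finite := by
  -- Both rows lie in the finite set of signed unit vectors.
  let u : Set (Fin 4 → ℝ) := ⋃ i, {Pi.single i 1, -Pi.single i 1}
  have hu : u.Finite := Set.finite_iUnion fun i => Set.toFinite _
  refine (Set.Finite.pi (t := fun _ : Fin 2 => u) fun _ => hu).subset ?_
  rintro A ⟨i, j, -, hi, hj, -⟩ k -
  fin_cases k
  · exact Set.mem_iUnion.2 ⟨i, hi⟩
  · exact Set.mem_iUnion.2 ⟨j, hj⟩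

theorem AdmissibleDPhi.mulVec_eq_zero {w₀ : Fin 4 → ℝ} {A : Matrix (Fin 2) (Fin 4) ℝ}
    (h : AdmissibleDPhi w₀ A) : A.mulVec w₀ = 0 := by
  obtain ⟨i, j, -, hi, hj, hwi, hwj⟩ := h
  ext k
  fin_cases k
  · change A 0 ⬝ᵥ w₀ = 0
    rcases hi with hi | hi <;> simp [hi, hwi]
  · change A 1 ⬝ᵥ w₀ = 0
    rcases hj with hj | hj <;> simp [hj, hwj]

/-- The three ways in which `φ` enters the Newton system at an admissible matrix. -/
theorem AdmissibleDPhi.cases {w₀ d : Fin 4 → ℝ} {A : Matrix (Fin 2) (Fin 4) ℝ}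
    (h : AdmissibleDPhi w₀ A) (hd : A.mulVec d = 0) :
    (w₀ 0 = 0 ∧ w₀ 1 = 0 ∧ d 0 = 0 ∧ d 1 = 0) ∨ (w₀ 0 = 0 ∧ w₀ 3 = 0 ∧ d 0 = 0 ∧ d 3 = 0) ∨
      (w₀ 1 = 0 ∧ w₀ 2 = 0 ∧ d 1 = 0 ∧ d 2 = 0) := by
  obtain ⟨i, j, hij, hi, hj, hwi, hwj⟩ := h
  have hdi : d i = 0 := by
    have : A 0 ⬝ᵥ d = 0 := congrFun hd 0
    rcases hi with hi | hi <;> simpa [hi] using this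
  have hdj : d j = 0 := by
    have : A 1 ⬝ᵥ d = 0 := congrFun hd 1
    rcases hj with hj | hj <;> simpa [hj] using this
  rcases hij with ⟨rfl, rfl⟩ | ⟨rfl, rfl⟩ | ⟨rfl, rfl⟩ | ⟨rfl, rfl⟩ | ⟨rfl, rfl⟩ | ⟨rfl, rfl⟩ <;>
    tauto

/-! ### Maps with a locally Lipschitz derivative -/

section LipschitzDerivative

variable {E E' E'' : Type*} [NormedAddCommGroup E] [NormedSpace ℝ E]
  [NormedAddCommGroup E'] [NormedSpace ℝ E'] [NormedAddCommGroup E''] [NormedSpace ℝ E'']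

/-- The class `C^{1,1}` of continuously differentiable maps with a locally Lipschitz derivative. -/
structure IsC11 (u : E → E') : Prop where
  contDiff : ContDiff ℝ 1 u
  locallyLipschitz_fderiv : LocallyLipschitz (fderiv ℝ u)

theorem IsC11.of_contDiff {u : E → E'} (hu : ContDiff ℝ 2 u) : IsC11 u :=
  ⟨hu.of_le (by norm_num), (hu.fderiv_right (m := 1) (by norm_num)).locallyLipschitz⟩

theorem LocallyLipschitz.clm_comp {X : Type*} [PseudoEMetricSpace X] {A : X → E' →L[ℝ] E''}
    {B : X → E →L[ℝ] E'} (hA : LocallyLipschitz A) (hB : LocallyLipschitz B) :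
    LocallyLipschitz fun x => (A x).comp (B x) := by
  have hC : ContDiff ℝ 1 fun q : (E' →L[ℝ] E'') × (E →L[ℝ] E') => q.1.comp q.2 :=
    contDiff_fst.clm_comp contDiff_snd
  exact LocallyLipschitz.comp (f := fun q : (E' →L[ℝ] E'') × (E →L[ℝ] E') => q.1.comp q.2)
    (g := fun x => (A x, B x)) hC.locallyLipschitz (hA.prodMk hB)

theorem IsC11.comp {v : E' → E''} {u : E → E'} (hv : IsC11 v) (hu : IsC11 u) :
    IsC11 (fun x => v (u x)) := by
  refine ⟨hv.contDiff.comp hu.contDiff, ?_⟩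
  have h : fderiv ℝ (fun x => v (u x)) = fun x => (fderiv ℝ v (u x)).comp (fderiv ℝ u x) :=
    funext fun x => fderiv_fun_comp x ((hv.contDiff.differentiable (by norm_num)) _)
      ((hu.contDiff.differentiable (by norm_num)) _)
  rw [h]
  exact LocallyLipschitz.clm_comp
    (LocallyLipschitz.comp (f := fderiv ℝ v) (g := u) hv.locallyLipschitz_fderiv
      hu.contDiff.locallyLipschitz) hu.locallyLipschitz_fderiv

theorem IsC11.prodMk {u : E → E'} {v : E → E''} (hu : IsC11 u) (hv : IsC11 v) :
    IsC11 (fun x => (u x, v x)) := by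
  refine ⟨hu.contDiff.prodMk hv.contDiff, ?_⟩
  have h : fderiv ℝ (fun x => (u x, v x)) = fun x => (fderiv ℝ u x).prod (fderiv ℝ v x) :=
    funext fun x => (((hu.contDiff.differentiable (by norm_num)) x).hasFDerivAt.prodMk
      ((hv.contDiff.differentiable (by norm_num)) x).hasFDerivAt).fderiv
  rw [h]
  exact LocallyLipschitz.comp
    (f := fun q : (E →L[ℝ] E') × (E →L[ℝ] E'') => q.1.prod q.2)
    (g := fun x => (fderiv ℝ u x, fderiv ℝ v x))
    (ContinuousLinearMap.prodₗᵢ ℝ).lipschitz.locallyLipschitz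
    (hu.locallyLipschitz_fderiv.prodMk hv.locallyLipschitz_fderiv)

theorem IsC11.add {u v : E → E'} (hu : IsC11 u) (hv : IsC11 v) : IsC11 (fun x => u x + v x) :=
  (IsC11.of_contDiff (u := fun q : E' × E' => q.1 + q.2) (by fun_prop)).comp (hu.prodMk hv)

theorem IsC11.smul {c : E → ℝ} {v : E → E'} (hc : IsC11 c) (hv : IsC11 v) :
    IsC11 (fun x => c x • v x) :=
  (IsC11.of_contDiff (u := fun q : ℝ × E' => q.1 • q.2) (by fun_prop)).comp (hc.prodMk hv)

theorem IsC11.sum {ι : Type*} (s : Finset ι) {u : ι → E → E'} (hu : ∀ i, IsC11 (u i)) :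
    IsC11 (fun x => ∑ i ∈ s, u i x) := by
  classical
  induction s using Finset.induction_on with
  | empty => simpa using IsC11.of_contDiff contDiff_const
  | insert i s hi ih =>
    simp only [Finset.sum_insert hi]
    exact (hu i).add ih

end LipschitzDerivative

/-! ### Gradients of the data -/

section Gradients

variable {n k : ℕ}

/-- The Riesz representation of functionals on `ℝⁿ`, as a linear (not conjugate-linear) map. -/
noncomputable def rieszVec (n : ℕ) : (Vec n →L[ℝ] ℝ) →L[ℝ] Vec n :=
  LinearMap.toContinuousLinearMap
    { toFun := (InnerProductSpace.toDual ℝ (Vec n)).symm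
      map_add' := fun a b => map_add _ a b
      map_smul' := fun c a => by simp }

theorem gradient_eq_rieszVec (u : Vec n → ℝ) (x : Vec n) :
    gradient u x = rieszVec n (fderiv ℝ u x) := rfl

theorem fderiv_component {u : Vec n → Vec k} (hu : Differentiable ℝ u) (i : Fin k) (x : Vec n) :
    fderiv ℝ (fun y => u y i) x = (EuclideanSpace.proj i : Vec k →L[ℝ] ℝ) ∘L fderiv ℝ u x :=
  (((EuclideanSpace.proj i : Vec k →L[ℝ] ℝ).hasFDerivAt).comp x (hu x).hasFDerivAt).fderiv

theorem gradComp_eq_rieszVec {u : Vec n → Vec k} (hu : Differentiable ℝ u) (i : Fin k)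
    (x : Vec n) : gradComp u i x
      = rieszVec n ((EuclideanSpace.proj i : Vec k →L[ℝ] ℝ) ∘L fderiv ℝ u x) := by
  rw [gradComp, gradient_eq_rieszVec, fderiv_component hu]

theorem inner_gradComp {u : Vec n → Vec k} (hu : Differentiable ℝ u) (i : Fin k) (x d : Vec n) :
    inner ℝ (gradComp u i x) d = fderiv ℝ u x d i := by
  rw [gradComp, gradient, InnerProductSpace.toDual_symm_apply, fderiv_component hu]
  rfl

theorem contDiff_gradient {u : Vec n → ℝ} (hu : ContDiff ℝ 2 u) :
    ContDiff ℝ 1 (gradient u) :=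
  (rieszVec n).contDiff.comp (hu.fderiv_right (m := 1) (by norm_num))

theorem contDiff_gradComp {u : Vec n → Vec k} (hu : ContDiff ℝ 2 u) (i : Fin k) :
    ContDiff ℝ 1 (gradComp u i) :=
  contDiff_gradient (by fun_prop)

theorem isC11_gradient {u : Vec n → ℝ} (hu : ContDiff ℝ 2 u)
    (hL : LocallyLipschitz (fderiv ℝ (fderiv ℝ u))) : IsC11 (gradient u) :=
  (IsC11.of_contDiff (rieszVec n).contDiff).comp ⟨hu.fderiv_right (m := 1) (by norm_num), hL⟩

theorem isC11_gradComp {u : Vec n → Vec k} (hu : ContDiff ℝ 2 u)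
    (hL : LocallyLipschitz (fderiv ℝ (fderiv ℝ u))) (i : Fin k) : IsC11 (gradComp u i) := by
  have h : gradComp u i = fun x => (rieszVec n ∘L
      ContinuousLinearMap.compL ℝ (Vec n) (Vec k) ℝ (EuclideanSpace.proj i)) (fderiv ℝ u x) :=
    funext fun x => gradComp_eq_rieszVec (hu.differentiable (by norm_num)) i x
  rw [h]
  exact (IsC11.of_contDiff (ContinuousLinearMap.contDiff _)).comp
    ⟨hu.fderiv_right (m := 1) (by norm_num), hL⟩

theorem hasFDerivAt_sum_smul_component {u : Vec n → Vec k} (hu : Differentiable ℝ u)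
    (q : Vec k) (x : Vec n) :
    HasFDerivAt (fun y => ∑ i, q i * u y i)
      (∑ i, q i • ((EuclideanSpace.proj i : Vec k →L[ℝ] ℝ) ∘L fderiv ℝ u x)) x :=
  HasFDerivAt.fun_sum fun i _ =>
    (((EuclideanSpace.proj i : Vec k →L[ℝ] ℝ).hasFDerivAt).comp x
      (hu x).hasFDerivAt).const_mul (q i)

end Gradients

/-! ### The Newton system as a selection of linear images of a smooth map -/

namespace MPCC

variable {n ℓ m p : ℕ} {P : MPCC n ℓ m p}

/-- The smoothness assumptions on the data. -/
structure IsC2 (P : MPCC n ℓ m p) : Prop where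
  f : ContDiff ℝ 2 P.f
  g : ContDiff ℝ 2 P.g
  h : ContDiff ℝ 2 P.h
  G : ContDiff ℝ 2 P.G
  H : ContDiff ℝ 2 P.H

theorem gradLagrangian_eq (hP : P.IsC2) (x : Vec n) (lam : Vec ℓ) (eta : Vec m) (mu nu : Vec p) :
    P.gradLagrangian x lam eta mu nu = gradient P.f x + ∑ i, lam i • gradComp P.g i x
      + ∑ i, eta i • gradComp P.h i x + ∑ i, mu i • gradComp P.G i x
      + ∑ i, nu i • gradComp P.H i x := by
  have hg := hP.g.differentiable (by norm_num)
  have hh := hP.h.differentiable (by norm_num)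
  have hG := hP.G.differentiable (by norm_num)
  have hH := hP.H.differentiable (by norm_num)
  have hd := ((((hP.f.differentiable (by norm_num)) x).hasFDerivAt.add
    (hasFDerivAt_sum_smul_component hg lam x)).add
    (hasFDerivAt_sum_smul_component hh eta x)).add
    (hasFDerivAt_sum_smul_component hG mu x) |>.add
    (hasFDerivAt_sum_smul_component hH nu x)
  have hd' : fderiv ℝ (fun y => P.lagrangian y lam eta mu nu) x = _ := hd.fderiv
  rw [gradLagrangian, gradient_eq_rieszVec, hd']
  simp only [map_add, map_sum, map_smul, gradComp_eq_rieszVec hg, gradComp_eq_rieszVec hh,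
    gradComp_eq_rieszVec hG, gradComp_eq_rieszVec hH, gradient_eq_rieszVec]

/-- The space of values of the smooth data of the Newton system: `∇ₓL`, `g`, `h`, `G`, `H` and the
multipliers `λ`, `μ`, `ν`. -/
abbrev SmoothData (n ℓ m p : ℕ) : Type :=
  Vec n × Vec ℓ × Vec m × Vec p × Vec p × Vec ℓ × Vec p × Vec p

variable (P) in
/-- The gradient of the Lagrangian as a function of all variables. -/
noncomputable def gradL (z : PrimalDual n ℓ m p) : Vec n :=
  P.gradLagrangian z.1 z.2.1 z.2.2.1 z.2.2.2.1 z.2.2.2.2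

variable (P) in
/-- The smooth inner map of the Newton system. -/
noncomputable def smoothData (z : PrimalDual n ℓ m p) : SmoothData n ℓ m p :=
  (P.gradL z, P.g z.1, P.h z.1, P.G z.1, P.H z.1, z.2.1, z.2.2.2.1, z.2.2.2.2)

theorem contDiff_gradL (hP : P.IsC2) : ContDiff ℝ 1 P.gradL := by
  have h : P.gradL = _ := funext fun z => gradLagrangian_eq hP _ _ _ _ _
  rw [h]
  have hfst : ContDiff ℝ 1 (fun z : PrimalDual n ℓ m p => z.1) := contDiff_fst
  have key {k : ℕ} {c : PrimalDual n ℓ m p → Vec k} (hc : ContDiff ℝ 1 c) {u : Vec n → Vec k}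
      (hu : ContDiff ℝ 2 u) : ContDiff ℝ 1 fun z => ∑ i, c z i • gradComp u i z.1 :=
    ContDiff.sum fun i _ =>
      have hci : ContDiff ℝ 1 fun z => c z i := by fun_prop
      hci.smul ((contDiff_gradComp hu i).comp hfst)
  exact ((((contDiff_gradient hP.f).comp hfst).add (key (by fun_prop) hP.g)).add
    (key (by fun_prop) hP.h)).add (key (by fun_prop) hP.G) |>.add (key (by fun_prop) hP.H)

theorem isC11_gradL (hP : P.IsC2) (hL : P.HasLocallyLipschitzSecondDerivatives) :
    IsC11 P.gradL := by
  have h : P.gradL = _ := funext fun z => gradLagrangian_eq hP _ _ _ _ _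
  rw [h]
  have hfst : IsC11 (fun z : PrimalDual n ℓ m p => z.1) := .of_contDiff contDiff_fst
  have key {k : ℕ} {c : PrimalDual n ℓ m p → Vec k} (hc : ContDiff ℝ 2 c) {u : Vec n → Vec k}
      (hu : ContDiff ℝ 2 u) (hu' : LocallyLipschitz (fderiv ℝ (fderiv ℝ u))) :
      IsC11 fun z => ∑ i, c z i • gradComp u i z.1 :=
    IsC11.sum _ fun i =>
      (IsC11.of_contDiff (by fun_prop)).smul ((isC11_gradComp hu hu' i).comp hfst)
  exact ((((isC11_gradient hP.f hL.1).comp hfst).add (key (by fun_prop) hP.g hL.2.1)).add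
    (key (by fun_prop) hP.h hL.2.2.1)).add (key (by fun_prop) hP.G hL.2.2.2.1)
    |>.add (key (by fun_prop) hP.H hL.2.2.2.2)

theorem contDiff_smoothData (hP : P.IsC2) : ContDiff ℝ 1 P.smoothData := by
  have h0 := contDiff_gradL hP
  have hg := hP.g.of_le (m := 1) (by norm_num)
  have hh := hP.h.of_le (m := 1) (by norm_num)
  have hG := hP.G.of_le (m := 1) (by norm_num)
  have hH := hP.H.of_le (m := 1) (by norm_num)
  unfold smoothData
  fun_prop

theorem isC11_smoothData (hP : P.IsC2) (hL : P.HasLocallyLipschitzSecondDerivatives) :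
    IsC11 P.smoothData := by
  have hg := hP.g
  have hh := hP.h
  have hG := hP.G
  have hH := hP.H
  exact (isC11_gradL hP hL).prodMk (.of_contDiff (by fun_prop))

theorem gradLagrangian_add_smul (hP : P.IsC2) (x : Vec n) (lam dlam : Vec ℓ) (eta deta : Vec m)
    (mu nu dmu dnu : Vec p) (t : ℝ) :
    P.gradLagrangian x (lam + t • dlam) (eta + t • deta) (mu + t • dmu) (nu + t • dnu)
      = P.gradLagrangian x lam eta mu nu + t • (∑ i, dlam i • gradComp P.g i x
        + ∑ i, deta i • gradComp P.h i x + ∑ i, dmu i • gradComp P.G i x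
        + ∑ i, dnu i • gradComp P.H i x) := by
  simp only [gradLagrangian_eq hP, PiLp.add_apply, PiLp.smul_apply, add_smul,
    Finset.sum_add_distrib, smul_add, Finset.smul_sum, smul_smul, smul_eq_mul]
  abel

theorem fderiv_gradL_apply (hP : P.IsC2) (x dx : Vec n) (lam dlam : Vec ℓ) (eta deta : Vec m)
    (mu nu dmu dnu : Vec p) :
    fderiv ℝ P.gradL (x, lam, eta, mu, nu) (dx, dlam, deta, dmu, dnu)
      = P.hessLagrangian x lam eta mu nu dx + (∑ i, dlam i • gradComp P.g i x
        + ∑ i, deta i • gradComp P.h i x + ∑ i, dmu i • gradComp P.G i x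
        + ∑ i, dnu i • gradComp P.H i x) := by
  have hd : HasFDerivAt P.gradL (fderiv ℝ P.gradL (x, lam, eta, mu, nu)) (x, lam, eta, mu, nu) :=
    ((contDiff_gradL hP).differentiable (by norm_num) _).hasFDerivAt
  have h₁ : fderiv ℝ P.gradL (x, lam, eta, mu, nu) (dx, 0)
      = P.hessLagrangian x lam eta mu nu dx := by
    have hc := HasFDerivAt.comp (f := fun y => (y, lam, eta, mu, nu)) x hd
      (hasFDerivAt_prodMk_left x (lam, eta, mu, nu))
    have hc' : P.hessLagrangian x lam eta mu nu = _ := hc.fderiv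
    rw [hc']
    rfl
  -- The gradient of the Lagrangian is affine in the multipliers, so its derivative in these
  -- directions can be read off from a line.
  have h₂ : fderiv ℝ P.gradL (x, lam, eta, mu, nu) (0, dlam, deta, dmu, dnu)
      = ∑ i, dlam i • gradComp P.g i x + ∑ i, deta i • gradComp P.h i x
        + ∑ i, dmu i • gradComp P.G i x + ∑ i, dnu i • gradComp P.H i x := by
    refine (hd.hasLineDerivAt (0, dlam, deta, dmu, dnu)).unique ?_
    unfold HasLineDerivAt
    have he : (fun t : ℝ => P.gradL ((x, lam, eta, mu, nu) + t • (0, dlam, deta, dmu, dnu)))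
        = fun t => P.gradLagrangian x lam eta mu nu + t • (∑ i, dlam i • gradComp P.g i x
          + ∑ i, deta i • gradComp P.h i x + ∑ i, dmu i • gradComp P.G i x
          + ∑ i, dnu i • gradComp P.H i x) := by
      funext t
      rw [← gradLagrangian_add_smul hP]
      simp [gradL]
    rw [he]
    simpa only [one_smul, id] using ((hasDerivAt_id (0 : ℝ)).smul_const _).const_add
      (P.gradLagrangian x lam eta mu nu)
  rw [← h₁, ← h₂, ← map_add]
  simp

set_option synthInstance.maxHeartbeats 200000 in
theorem fderiv_smoothData_apply (hP : P.IsC2) (z d : PrimalDual n ℓ m p) :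
    fderiv ℝ P.smoothData z d = (fderiv ℝ P.gradL z d, fderiv ℝ P.g z.1 d.1, fderiv ℝ P.h z.1 d.1,
      fderiv ℝ P.G z.1 d.1, fderiv ℝ P.H z.1 d.1, d.2.1, d.2.2.2.1, d.2.2.2.2) := by
  have key {k : ℕ} {u : Vec n → Vec k} (hu : ContDiff ℝ 2 u) :
      HasFDerivAt (fun z : PrimalDual n ℓ m p => u z.1)
        (fderiv ℝ u z.1 ∘L (ContinuousLinearMap.fst ℝ _ _ ∘L ContinuousLinearMap.id ℝ _)) z :=
    HasFDerivAt.comp (g := u) z ((hu.differentiable (by norm_num)) z.1).hasFDerivAt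
      (hasFDerivAt_id z).fst
  have h0 := ((contDiff_gradL hP).differentiable (by norm_num) z).hasFDerivAt
  have hid := hasFDerivAt_id (𝕜 := ℝ) z
  have h := h0.prodMk ((key hP.g).prodMk ((key hP.h).prodMk ((key hP.G).prodMk ((key hP.H).prodMk
    (hid.snd.fst.prodMk (hid.snd.snd.snd.fst.prodMk hid.snd.snd.snd.snd))))))
  have h' : fderiv ℝ P.smoothData z = _ := h.fderiv
  rw [h']
  rfl

/-- The linear outer map of the Newton system for given selections `r` of the entries of
`(-g_i, λ_i)` and given Newton matrices `A` of `φ`. -/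
noncomputable def selectionMap (n m : ℕ) (r : Fin ℓ → Fin 2 → ℝ)
    (A : Fin p → Matrix (Fin 2) (Fin 4) ℝ) :
    SmoothData n ℓ m p →L[ℝ] Residual n ℓ m p :=
  LinearMap.toCLMOfNormed
    { toFun := fun (v, g, h, G, H, lam, mu, nu) =>
        (v, WithLp.toLp 2 fun i => r i 0 * (-g i) + r i 1 * lam i, h,
          WithLp.toLp 2 fun ic => (A ic.1).mulVec ![G ic.1, H ic.1, mu ic.1, nu ic.1] ic.2)
      map_add' := by
        rintro ⟨v, g, h, G, H, lam, mu, nu⟩ ⟨v', g', h', G', H', lam', mu', nu'⟩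
        simp only [Prod.mk_add_mk, Prod.mk.injEq, true_and]
        refine ⟨?_, ?_⟩
        · ext i
          simp only [PiLp.add_apply]
          ring
        · ext i
          simp only [PiLp.add_apply, Matrix.mulVec, dotProduct, Fin.sum_univ_four,
            Matrix.cons_val]
          ring
      map_smul' := by
        rintro c ⟨v, g, h, G, H, lam, mu, nu⟩
        simp only [Prod.smul_mk, Prod.mk.injEq, true_and, RingHom.id_apply]
        refine ⟨?_, ?_⟩
        · ext i
          simp only [PiLp.smul_apply, smul_eq_mul]
          ring
        · ext i
          simp only [PiLp.smul_apply, smul_eq_mul, Matrix.mulVec, dotProduct, Fin.sum_univ_four,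
            Matrix.cons_val]
          ring }

theorem selectionMap_apply (r : Fin ℓ → Fin 2 → ℝ) (A : Fin p → Matrix (Fin 2) (Fin 4) ℝ)
    (v : Vec n) (g lam : Vec ℓ) (h : Vec m) (G H mu nu : Vec p) :
    selectionMap n m r A (v, g, h, G, H, lam, mu, nu)
      = (v, WithLp.toLp 2 fun i => r i 0 * (-g i) + r i 1 * lam i, h,
          WithLp.toLp 2 fun ic => (A ic.1).mulVec ![G ic.1, H ic.1, mu ic.1, nu ic.1] ic.2) :=
  rfl

theorem F_eq_selectionMap (z : PrimalDual n ℓ m p) :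
    P.F z = selectionMap n m (fun i => DMin ![-P.g z.1 i, z.2.1 i])
      (fun i => DPhi (P.compArg z i)) (P.smoothData z) := by
  obtain ⟨x, lam, eta, mu, nu⟩ := z
  rw [smoothData, selectionMap_apply]
  simp only [F, ← DMin_pair_dot, phi_eq_mulVec]
  rfl

theorem DF_eq_selectionMap (hP : P.IsC2) (z : PrimalDual n ℓ m p) :
    P.DF z = selectionMap n m (fun i => DMin ![-P.g z.1 i, z.2.1 i])
      (fun i => DPhi (P.compArg z i)) ∘L fderiv ℝ P.smoothData z := by
  refine ContinuousLinearMap.ext fun d => ?_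
  obtain ⟨x, lam, eta, mu, nu⟩ := z
  obtain ⟨dx, dlam, deta, dmu, dnu⟩ := d
  rw [ContinuousLinearMap.comp_apply, fderiv_smoothData_apply hP, fderiv_gradL_apply hP,
    selectionMap_apply]
  change P.DFFun (x, lam, eta, mu, nu) (dx, dlam, deta, dmu, dnu) = _
  simp only [DFFun, inner_gradComp (hP.g.differentiable two_ne_zero),
    inner_gradComp (hP.h.differentiable two_ne_zero),
    inner_gradComp (hP.G.differentiable two_ne_zero),
    inner_gradComp (hP.H.differentiable two_ne_zero), add_assoc]

/-! ### Nonsingularity of the Newton matrices -/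

/-- A Newton derivative of `min (-g, λ)` that selects an entry vanishing at `(g₀, lam₀)`. -/
def AdmissibleDMin (g₀ lam₀ : ℝ) (r : Fin 2 → ℝ) : Prop :=
  (r = Pi.single 0 1 ∧ g₀ = 0) ∨ (r = Pi.single 1 1 ∧ lam₀ = 0)

theorem finite_admissibleDMin (g₀ lam₀ : ℝ) : {r | AdmissibleDMin g₀ lam₀ r}.Finite :=
  (Set.toFinite {Pi.single 0 1, Pi.single 1 1}).subset fun _ hr => hr.imp And.left And.left

/-- The hypotheses express `min (-g a, lam a) = 0`. -/
theorem eventually_admissibleDMin {X : Type*} [TopologicalSpace X] {g lam : X → ℝ} {a : X}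
    (hg : ContinuousAt g a) (hlam : ContinuousAt lam a) (hga : g a ≤ 0)
    (hpos : g a = 0 → 0 ≤ lam a) (hzero : g a ≠ 0 → lam a = 0) :
    ∀ᶠ z in 𝓝 a, AdmissibleDMin (g a) (lam a) (DMin ![-g z, lam z]) := by
  by_cases h0 : g a = 0
  · rcases (hpos h0).eq_or_lt with hl | hl
    · exact Eventually.of_forall fun z =>
        (DMin_pair _ _).imp (fun h => ⟨h.1, h0⟩) fun h => ⟨h.1, hl.symm⟩
    · filter_upwards [hg.neg.eventually_lt hlam (by simpa [h0] using hl)] with z hz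
      rcases DMin_pair (-g z) (lam z) with ⟨h, -⟩ | ⟨-, h⟩
      · exact Or.inl ⟨h, h0⟩
      · exact absurd (min_eq_right_iff.1 h) (not_le.2 hz)
  · have hl := hzero h0
    have hlt : lam a < -g a := by
      rw [hl]
      exact neg_pos.2 (lt_of_le_of_ne hga h0)
    filter_upwards [hlam.eventually_lt hg.neg hlt] with z hz
    rcases DMin_pair (-g z) (lam z) with ⟨-, h⟩ | ⟨h, -⟩
    · exact absurd (min_eq_left_iff.1 h) (not_le.2 hz)
    · exact Or.inr ⟨h, hl⟩

theorem compArg_mem_mSet {x : Vec n} (hx : P.IsFeasible x) {lam : Vec ℓ} {eta : Vec m}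
    {mu nu : Vec p} (hmult : (lam, eta, mu, nu) ∈ P.multipliersM x) (i : Fin p) :
    P.compArg (x, lam, eta, mu, nu) i ∈ mSet := by
  obtain ⟨-, -, hG, hH, hGH⟩ := hx
  obtain ⟨-, -, -, hmu, hnu, hmunu⟩ := hmult
  have hi : P.G x i * P.H x i = 0 :=
    (Finset.sum_eq_zero_iff_of_nonneg fun j _ => mul_nonneg (hG j) (hH j)).1 hGH i
      (Finset.mem_univ i)
  simp only [mSet, compArg, Set.mem_ofPred_eq, Matrix.cons_val]
  rcases (hG i).eq_or_lt with h0 | hpos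
  · rcases (hH i).eq_or_lt with h0' | hpos'
    · exact Or.inr (Or.inr ⟨h0.symm, h0'.symm, hmunu i ⟨h0.symm, h0'.symm⟩⟩)
    · exact Or.inr (Or.inl ⟨h0.symm, hpos', hnu i ⟨h0.symm, hpos'⟩⟩)
  · have hH0 : P.H x i = 0 := (mul_eq_zero.1 hi).resolve_left hpos.ne'
    exact Or.inl ⟨hpos, hH0, hmu i ⟨hpos, hH0⟩⟩

theorem sum_subtype_eq_sum {ι M : Type*} [Fintype ι] [AddCommMonoid M] (s : Set ι) [Fintype s]
    {f : ι → M} (h : ∀ i ∉ s, f i = 0) : ∑ i : s, f i = ∑ i, f i := by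
  rw [Finset.sum_set_coe]
  exact Finset.sum_subset (Finset.subset_univ _) fun i _ hi => h i (by simpa using hi)

/-- The index sets of MPCC-LICQ may be replaced by all indices if the coefficients of the
remaining gradients vanish. -/
theorem LICQ.eq_zero {x : Vec n} (hLICQ : P.LICQ x) {dlam : Vec ℓ} {deta : Vec m}
    {dmu dnu : Vec p} (hlam : ∀ i ∉ P.Ig x, dlam i = 0)
    (hmu : ∀ i ∉ P.IZeroPos x ∪ P.IZeroZero x, dmu i = 0)
    (hnu : ∀ i ∉ P.IPosZero x ∪ P.IZeroZero x, dnu i = 0)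
    (hsum : ∑ i, dlam i • gradComp P.g i x + ∑ i, deta i • gradComp P.h i x
      + ∑ i, dmu i • gradComp P.G i x + ∑ i, dnu i • gradComp P.H i x = 0) :
    dlam = 0 ∧ deta = 0 ∧ dmu = 0 ∧ dnu = 0 := by
  classical
  have hli := Fintype.linearIndependent_iff.1 hLICQ
    (Sum.elim (fun i => dlam i) (Sum.elim (fun i => deta i)
      (Sum.elim (fun i => dmu i) (fun i => dnu i)))) (by
        simp only [Fintype.sum_sum_type, Sum.elim_inl, Sum.elim_inr]
        rw [sum_subtype_eq_sum (P.Ig x) (f := fun i => dlam i • gradComp P.g i x)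
            (fun i hi => by rw [hlam i hi, zero_smul]),
          sum_subtype_eq_sum (P.IZeroPos x ∪ P.IZeroZero x)
            (f := fun i => dmu i • gradComp P.G i x) (fun i hi => by rw [hmu i hi, zero_smul]),
          sum_subtype_eq_sum (P.IPosZero x ∪ P.IZeroZero x)
            (f := fun i => dnu i • gradComp P.H i x) (fun i hi => by rw [hnu i hi, zero_smul]),
          ← hsum]
        abel)
  refine ⟨?_, ?_, ?_, ?_⟩
  · ext i
    by_cases hi : i ∈ P.Ig x
    · exact hli (Sum.inl ⟨i, hi⟩)
    · exact hlam i hi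
  · ext i
    exact hli (Sum.inr (Sum.inl i))
  · ext i
    by_cases hi : i ∈ P.IZeroPos x ∪ P.IZeroZero x
    · exact hli (Sum.inr (Sum.inr (Sum.inl ⟨i, hi⟩)))
    · exact hmu i hi
  · ext i
    by_cases hi : i ∈ P.IPosZero x ∪ P.IZeroZero x
    · exact hli (Sum.inr (Sum.inr (Sum.inr ⟨i, hi⟩)))
    · exact hnu i hi

theorem inner_sum_smul_eq_zero {k : ℕ} {d : Vec n} {q : Vec k} {v : Fin k → Vec n}
    (h : ∀ i, q i * inner ℝ (v i) d = 0) : inner ℝ d (∑ i, q i • v i) = 0 := by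
  rw [inner_sum]
  exact Finset.sum_eq_zero fun i _ => by rw [inner_smul_right, real_inner_comm, h i]

/-- The linearized M-stationarity system has only the trivial solution, whichever admissible
selection is made: the products of `dlam i`, `dmu i`, `dnu i` with the corresponding directional
derivatives along `dx` all vanish, so testing the first equation with `dx` leaves the quadratic
form of the Hessian. -/
theorem eq_zero_of_linearized_system {x : Vec n} (hx : P.IsFeasible x) (hLICQ : P.LICQ x)
    {lam : Vec ℓ} {eta : Vec m} {mu nu : Vec p} (hSSOC : P.SSOC x lam eta mu nu)
    {dx : Vec n} {dlam : Vec ℓ} {deta : Vec m} {dmu dnu : Vec p}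
    (h₁ : P.hessLagrangian x lam eta mu nu dx + (∑ i, dlam i • gradComp P.g i x
      + ∑ i, deta i • gradComp P.h i x + ∑ i, dmu i • gradComp P.G i x
      + ∑ i, dnu i • gradComp P.H i x) = 0)
    (hg : ∀ i, (P.g x i = 0 ∧ inner ℝ (gradComp P.g i x) dx = 0) ∨ (lam i = 0 ∧ dlam i = 0))
    (hh : ∀ i, inner ℝ (gradComp P.h i x) dx = 0)
    (hGH : ∀ i,
      (P.G x i = 0 ∧ P.H x i = 0 ∧
        inner ℝ (gradComp P.G i x) dx = 0 ∧ inner ℝ (gradComp P.H i x) dx = 0) ∨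
      (P.G x i = 0 ∧ nu i = 0 ∧ inner ℝ (gradComp P.G i x) dx = 0 ∧ dnu i = 0) ∨
      (P.H x i = 0 ∧ mu i = 0 ∧ inner ℝ (gradComp P.H i x) dx = 0 ∧ dmu i = 0))
    (hlam : ∀ i, P.g x i ≠ 0 → dlam i = 0) :
    dx = 0 ∧ dlam = 0 ∧ deta = 0 ∧ dmu = 0 ∧ dnu = 0 := by
  have hdir : dx ∈ P.ssocDirections x lam mu nu := by
    refine ⟨fun i _ hi => ?_, hh, fun i hi => ?_, fun i hi => ?_, fun i _ => ?_⟩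
    · rcases hg i with h | h
      · exact h.2
      · exact absurd h.1 hi.ne'
    · rcases hGH i with h | h | h
      · exact h.2.2.1
      · exact h.2.2.1
      · rcases hi with hi | hi
        · exact absurd h.1 hi.2.ne'
        · exact absurd h.2.1 hi.2
    · rcases hGH i with h | h | h
      · exact h.2.2.2
      · rcases hi with hi | hi
        · exact absurd h.1 hi.1.ne'
        · exact absurd h.2.1 hi.2
      · exact h.2.2.1
    · rcases hGH i with h | h | h <;> simp [h.2.2.1]
  have hquad : inner ℝ dx (P.hessLagrangian x lam eta mu nu dx) = 0 := by
    have h := congrArg (inner ℝ dx) h₁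
    have e₁ : inner ℝ dx (∑ i, dlam i • gradComp P.g i x) = 0 :=
      inner_sum_smul_eq_zero fun i => by rcases hg i with h | h <;> simp [h.2]
    have e₂ : inner ℝ dx (∑ i, deta i • gradComp P.h i x) = 0 :=
      inner_sum_smul_eq_zero fun i => by simp [hh i]
    have e₃ : inner ℝ dx (∑ i, dmu i • gradComp P.G i x) = 0 :=
      inner_sum_smul_eq_zero fun i => by rcases hGH i with h | h | h <;> simp [h.2.2]
    have e₄ : inner ℝ dx (∑ i, dnu i • gradComp P.H i x) = 0 :=
      inner_sum_smul_eq_zero fun i => by rcases hGH i with h | h | h <;> simp [h.2.2]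
    simpa only [inner_add_right, e₁, e₂, e₃, e₄, add_zero, inner_zero_right] using h
  have hdx : dx = 0 := by
    by_contra hne
    exact (hSSOC dx hdir hne).ne' hquad
  refine ⟨hdx, hLICQ.eq_zero hlam (fun i hi => ?_) (fun i hi => ?_) ?_⟩
  · rcases hGH i with h | h | h
    · exact absurd (Or.inr ⟨h.1, h.2.1⟩) hi
    · rcases (hx.2.2.2.1 i).eq_or_lt with h' | h'
      · exact absurd (Or.inr ⟨h.1, h'.symm⟩) hi
      · exact absurd (Or.inl ⟨h.1, h'⟩) hi
    · exact h.2.2.2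
  · rcases hGH i with h | h | h
    · exact absurd (Or.inr ⟨h.1, h.2.1⟩) hi
    · exact h.2.2.2
    · rcases (hx.2.2.1 i).eq_or_lt with h' | h'
      · exact absurd (Or.inr ⟨h'.symm, h.1⟩) hi
      · exact absurd (Or.inl ⟨h', h.1⟩) hi
  · simpa [hdx] using h₁

theorem finrank_primalDual_eq_finrank_residual (n ℓ m p : ℕ) :
    Module.finrank ℝ (PrimalDual n ℓ m p) = Module.finrank ℝ (Residual n ℓ m p) := by
  simp only [Module.finrank_prod, finrank_euclideanSpace, Fintype.card_prod, Fintype.card_fin]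
  ring

theorem selectionMap_comp_isInvertible (hP : P.IsC2) {x : Vec n} (hx : P.IsFeasible x)
    (hLICQ : P.LICQ x) {lam : Vec ℓ} {eta : Vec m} {mu nu : Vec p}
    (hSSOC : P.SSOC x lam eta mu nu)
    {r : Fin ℓ → Fin 2 → ℝ} {A : Fin p → Matrix (Fin 2) (Fin 4) ℝ}
    (hr : ∀ i, AdmissibleDMin (P.g x i) (lam i) (r i))
    (hA : ∀ i, AdmissibleDPhi (P.compArg (x, lam, eta, mu, nu) i) (A i)) :
    (selectionMap n m r A ∘L fderiv ℝ P.smoothData (x, lam, eta, mu, nu)).IsInvertible := by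
  refine ContinuousLinearMap.isInvertible_of_ker_eq_zero
    (finrank_primalDual_eq_finrank_residual n ℓ m p) fun d hd => ?_
  obtain ⟨dx, dlam, deta, dmu, dnu⟩ := d
  rw [ContinuousLinearMap.comp_apply, fderiv_smoothData_apply hP, fderiv_gradL_apply hP,
    selectionMap_apply] at hd
  simp only [Prod.mk_eq_zero] at hd
  obtain ⟨h₁, h₂, h₃, h₄⟩ := hd
  have h₂' (i) : r i 0 * (-fderiv ℝ P.g x dx i) + r i 1 * dlam i = 0 := congrArg (· i) h₂
  have h₄' (i) : (A i).mulVec ![fderiv ℝ P.G x dx i, fderiv ℝ P.H x dx i, dmu i, dnu i] = 0 :=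
    funext fun k => congrArg (· (i, k)) h₄
  simp only [← inner_gradComp (hP.g.differentiable two_ne_zero)] at h₂'
  simp only [← inner_gradComp (hP.G.differentiable two_ne_zero),
    ← inner_gradComp (hP.H.differentiable two_ne_zero)] at h₄'
  have hz := eq_zero_of_linearized_system hx hLICQ hSSOC h₁
    (fun i => (hr i).imp
      (fun h => ⟨h.2, by simpa [h.1] using h₂' i⟩) fun h => ⟨h.2, by simpa [h.1] using h₂' i⟩)
    (fun i => by
      rw [inner_gradComp (hP.h.differentiable two_ne_zero)]
      exact congrArg (· i) h₃)
    (fun i => (hA i).cases (h₄' i))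
    (fun i hi => by
      rcases hr i with h | h
      · exact absurd h.2 hi
      · simpa [h.1] using h₂' i)
  simp [hz]

theorem selectionMap_smoothData_eq_zero {x : Vec n} (hh : ∀ i, P.h x i = 0)
    {lam : Vec ℓ} {eta : Vec m} {mu nu : Vec p} (hL : P.gradLagrangian x lam eta mu nu = 0)
    {r : Fin ℓ → Fin 2 → ℝ} {A : Fin p → Matrix (Fin 2) (Fin 4) ℝ}
    (hr : ∀ i, AdmissibleDMin (P.g x i) (lam i) (r i))
    (hA : ∀ i, AdmissibleDPhi (P.compArg (x, lam, eta, mu, nu) i) (A i)) :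
    selectionMap n m r A (P.smoothData (x, lam, eta, mu, nu)) = 0 := by
  rw [smoothData, selectionMap_apply]
  simp only [Prod.mk_eq_zero]
  refine ⟨hL, ?_, ?_, ?_⟩
  · ext i
    rcases hr i with h | h <;> simp [h.1, h.2]
  · ext i
    exact hh i
  · ext ⟨i, k⟩
    exact congrFun (hA i).mulVec_eq_zero k

end MPCC

/-! ### Local convergence for the M-stationarity system -/

open MPCC

theorem mainTheorem1 {n ℓ m p : ℕ} (P : MPCC n ℓ m p)
    (hf : ContDiff ℝ 2 P.f) (hg : ContDiff ℝ 2 P.g) (hh : ContDiff ℝ 2 P.h)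
    (hG : ContDiff ℝ 2 P.G) (hH : ContDiff ℝ 2 P.H)
    (x : Vec n) (hx : P.IsMStationary x) (hLICQ : P.LICQ x)
    (lam : Vec ℓ) (eta : Vec m) (mu nu : Vec p)
    (hmult : (lam, eta, mu, nu) ∈ P.multipliersM x)
    (hSSOC : P.SSOC x lam eta mu nu) :
    ∃ δ : ℝ, 0 < δ ∧
      (∀ z₀ ∈ Metric.closedBall ((x, lam, eta, mu, nu) : PrimalDual n ℓ m p) δ,
        NewtonWellDefined P.F P.DF z₀ ∧
        ConvergesSuperlinearly (newtonSeq P.F P.DF z₀) (x, lam, eta, mu, nu)) ∧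
      (P.HasLocallyLipschitzSecondDerivatives →
        ∀ z₀ ∈ Metric.closedBall ((x, lam, eta, mu, nu) : PrimalDual n ℓ m p) δ,
          ConvergesQuadratically (newtonSeq P.F P.DF z₀) (x, lam, eta, mu, nu)) := by
  have hP : P.IsC2 := ⟨hf, hg, hh, hG, hH⟩
  have hfeas := hx.1
  have hmS := compArg_mem_mSet hfeas hmult
  obtain ⟨hL, hlam, hlam', -⟩ := hmult
  let R : Set (Fin ℓ → Fin 2 → ℝ) :=
    Set.univ.pi fun i => {r | AdmissibleDMin (P.g x i) (lam i) r}
  let T : Set (Fin p → Matrix (Fin 2) (Fin 4) ℝ) :=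
    Set.univ.pi fun i => {A | AdmissibleDPhi (P.compArg (x, lam, eta, mu, nu) i) A}
  have hR : R.Finite := Set.Finite.pi fun i => finite_admissibleDMin _ _
  have hT : T.Finite := Set.Finite.pi fun i => finite_admissibleDPhi _
  have hselR : ∀ᶠ z : PrimalDual n ℓ m p in 𝓝 (x, lam, eta, mu, nu),
      (fun i => DMin ![-P.g z.1 i, z.2.1 i]) ∈ R := by
    simp only [R, Set.mem_univ_pi, Set.mem_ofPred_eq]
    refine eventually_all.2 fun i => ?_
    have hgc := hg.continuous
    exact eventually_admissibleDMin (X := PrimalDual n ℓ m p) (g := fun z => P.g z.1 i)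
      (lam := fun z => z.2.1 i) (a := (x, lam, eta, mu, nu))
      (Continuous.continuousAt (by fun_prop)) (Continuous.continuousAt (by fun_prop))
      (hfeas.1 i) (hlam i) (hlam' i)
  have hselT : ∀ᶠ z : PrimalDual n ℓ m p in 𝓝 (x, lam, eta, mu, nu),
      (fun i => DPhi (P.compArg z i)) ∈ T := by
    simp only [T, Set.mem_univ_pi, Set.mem_ofPred_eq]
    refine eventually_all.2 fun i => ?_
    have hc : Continuous fun z : PrimalDual n ℓ m p => P.compArg z i := by
      have hGc := hG.continuous
      have hHc := hH.continuous
      refine continuous_pi fun k => ?_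
      fin_cases k <;> simp only [compArg] <;> dsimp <;> fun_prop
    exact hc.continuousAt.eventually (eventually_admissibleDPhi (hmS i))
  obtain ⟨δ, hδ, h₁, h₂⟩ := newtonSeq_converges_of_selection (Φ := P.F) (DΦ := P.DF)
    (contDiff_smoothData hP) (a := (x, lam, eta, mu, nu)) (hR.image2 (selectionMap n m) hT)
    (by
      rintro _ ⟨r, hr, A, hA, rfl⟩
      exact selectionMap_smoothData_eq_zero hfeas.2.1 hL (fun i => hr i trivial)
        fun i => hA i trivial)
    (by
      rintro _ ⟨r, hr, A, hA, rfl⟩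
      exact selectionMap_comp_isInvertible hP hfeas hLICQ hSSOC (fun i => hr i trivial)
        fun i => hA i trivial)
    (by
      filter_upwards [hselR, hselT] with z hz hz'
      exact ⟨_, ⟨_, hz, _, hz', rfl⟩, F_eq_selectionMap z, DF_eq_selectionMap hP z⟩)
  exact ⟨δ, hδ, h₁, fun hLip => h₂ (isC11_smoothData hP hLip).locallyLipschitz_fderiv⟩
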